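/- **Setting.** Consider a simple step-stress accelerated life test with stress levels $x_1<x_2$ and inspection times $0=t_0<t_1<\dots<t_L$, where the stress is raised from $x_1$ to $x_2$ at $\tau=t_k$ for some $1\le k<L$. The baseline hazard is $h_0(t)=\sum_{i=0}^m\gamma_it^i$ with $m=1$ (linear) or $m=2$ (quadratic), $H_0(t)=\int_0^th_0=\sum_{i=0}^m\gamma_it^{i+1}/(i+1)$, and the parameter is $\theta=(\gamma_0,\dots,\gamma_m,a_1)\in\Theta=(0,\infty)^{m+2}$. Under proportional hazards and cumulative exposure, a lifetime has reliability $R_\theta(t)=e^{-H_\theta(t)}$ with $H_\theta(t)=e^{a_1x_1}H_0(t)$ for $t<\tau$ and $H_\theta(t)=e^{a_1x_2}H_0(t+s)$ for $t\ge\tau$, where $s=s(\theta)$ is the greatest negative solution of $H_0(\tau+s)=e^{a_1(x_1-x_2)}H_0(\tau)$. The same formulas are used on $[0,\infty)^{m+2}$ (with $s=0$ if $a_1=0$). The cell probabilities are $\pi_j(\theta)=R_\theta(t_{j-1})-R_\theta(t_j)$ for $1\le j\le L$ and $\pi_{L+1}(\theta)=R_\theta(t_L)$. For a count vector $n=(n_1,\dots,n_{L+1})$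 with $N=\sum_jn_j$ put $\hat p=n/N$. For $\beta\ge0$ an MDPDE is a minimizer over $\theta\in\Theta$ of $d_\beta(\hat p,\pi(\theta))$, where $$d_\beta(p,q)=\sum_j\Big(q_j^{\beta+1}-\big(1+\tfrac1\beta\big)q_j^\beta p_j+\tfrac1\beta p_j^{\beta+1}\Big)\ (\beta>0),\qquad d_0(p,q)=\sum_jp_j\log\frac{p_j}{q_j}.$$ Let $W(\theta)=(\partial\pi_j/\partial\theta_i)_{j,i}$ be the $(L+1)\times(m+2)$ Jacobian matrix of $\pi$, $D(\theta)=\operatorname{diag}(\pi(\theta))$, $\pi^\beta=(\pi_j^\beta)_j$, and $$J_\beta=W^TD^{\beta-1}W,\qquad K_\beta=W^T\big(D^{2\beta-1}-\pi^\beta(\pi^\beta)^T\big)W,\qquad \Sigma_\beta=J_\beta^{-1}K_\beta J_\beta^{-1}.$$ **Theorem.** Let $\beta\ge0$, let $\theta^*\in\Theta$ be the true parameter, and for each $N$ let the counts be multinomial with $N$ trials and cell probabilities $\pi(\theta^*)$. Let $\hat\theta^\beta=\hat\theta^\beta_N$ be a random vector that is almost surely an MDPDE for these counts whenever one exists (and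 is arbitrary otherwise). Assume that $k\ge m+1$ or $L-k\ge m+1$; or else that $J_\beta(\theta^*)$ is nonsingular and $\theta^*$ is identifiable, i.e. $\pi(\theta)=\pi(\theta^*)$ with $\theta\in[0,\infty)^{m+2}$ implies $\theta=\theta^*$. Then $\pi$ is differentiable at $\theta^*$, $J_\beta(\theta^*)$ is nonsingular, $\Sigma_\beta(\theta^*)$ is positive semidefinite, and $$\sqrt N\,(\hat\theta^\beta-\theta^*)\xrightarrow[N\to\infty]{\mathcal L}\mathcal N\big(0,\Sigma_\beta(\theta^*)\big).$$ For $\beta=0$ the MDPDE is the MLE: for all counts, $\theta$ minimizes $d_0(\hat p,\pi(\cdot))$ over $\Theta$ if and only if it maximizes $\sum_jn_j\log\pi_j(\cdot)$ over $\Theta$. Moreover the Fisher information matrix of one device, $I_F(\theta^*)=\sum_j\pi_j\,(\nabla\log\pi_j)(\nabla\log\pi_j)^T$ at $\theta^*$, equals $W^TD^{-1}W$ at $\theta^*$, and $\Sigma_0(\theta^*)=I_F(\theta^*)^{-1}$. -/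

import Mathlib

open MeasureTheory ProbabilityTheory Filter Topology

noncomputable section

namespace StepStress

/-- A simple step-stress accelerated life test with interval monitoring: stress levels `x₁ < x₂`,
inspection times `0 = t₀ < t₁ < ⋯ < t_L`, and stress change at the inspection time `τ = t_k`
with `1 ≤ k < L`. -/
structure Design (L : ℕ) where
  x₁ : ℝ
  x₂ : ℝ
  stress_lt : x₁ < x₂
  t : Fin (L + 1) → ℝ
  t_zero : t 0 = 0
  t_strictMono : StrictMono t
  k : Fin (L + 1)
  k_pos : 0 < k
  k_lt : k < Fin.last L

/-- The model parameter `θ = (γ₀, …, γ_m, a₁)` for a polynomial baseline hazard of degree `m`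
(`m = 1`: linear, `m = 2`: quadratic). -/
abbrev Param (m : ℕ) : Type := EuclideanSpace ℝ (Fin (m + 2))

/-- The baseline hazard coefficient `γᵢ`. -/
def gam {m : ℕ} (θ : Param m) (i : Fin (m + 1)) : ℝ := θ i.castSucc

/-- The regression coefficient `a₁` of the stress. -/
def slope {m : ℕ} (θ : Param m) : ℝ := θ (Fin.last (m + 1))

/-- The parameter space: all coordinates positive. -/
def paramSpace (m : ℕ) : Set (Param m) := {θ | ∀ i, 0 < θ i}

/-- The cumulative baseline hazard `∫₀ᵗ h₀ = γ₀ t + γ₁ t² / 2 + ⋯ + γ_m t^(m+1) / (m+1)` of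
`h₀(t) = γ₀ + γ₁ t + ⋯ + γ_m t^m`. -/
def baseCumHazard {m : ℕ} (θ : Param m) (t : ℝ) : ℝ :=
  ∑ i : Fin (m + 1), gam θ i * t ^ ((i : ℕ) + 1) / ((i : ℕ) + 1)

variable {L m : ℕ} (S : Design L)

/-- The time of stress change. -/
def Design.τ : ℝ := S.t S.k

/-- The shifting time of the cumulative exposure model: the greatest negative solution `s` of
`H₀(τ + s) = exp(a₁ (x₁ - x₂)) H₀(τ)`. On the parameter space `s = 0` is not a solution; it is
admitted so that the definition also makes sense on the boundary `a₁ = 0`, where `s = 0`. -/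
def Design.shift (θ : Param m) : ℝ :=
  sSup {s : ℝ | s ≤ 0 ∧ baseCumHazard θ (S.τ + s)
    = Real.exp (slope θ * (S.x₁ - S.x₂)) * baseCumHazard θ S.τ}

/-- The cumulative hazard of a lifetime in the step-stress experiment. -/
def Design.cumHazard (θ : Param m) (t : ℝ) : ℝ :=
  if t < S.τ then Real.exp (slope θ * S.x₁) * baseCumHazard θ t
  else Real.exp (slope θ * S.x₂) * baseCumHazard θ (t + S.shift θ)

/-- The reliability function. -/
def Design.reliability (θ : Param m) (t : ℝ) : ℝ := Real.exp (-S.cumHazard θ t)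

/-- The cell probabilities `π(θ)`: failure in the `L` inspection intervals, and survival at the
termination time `t_L` in the last cell. -/
def Design.cellProb (θ : Param m) : Fin (L + 1) → ℝ :=
  Fin.snoc (α := fun _ => ℝ)
    (fun j : Fin L => S.reliability θ (S.t j.castSucc) - S.reliability θ (S.t j.succ))
    (S.reliability θ (S.t (Fin.last L)))

/-- The density power divergence between probability vectors; at `β = 0` the Kullback-Leibler
divergence. -/
def dpd {ι : Type*} [Fintype ι] (β : ℝ) (p q : ι → ℝ) : ℝ :=
  if β = 0 then ∑ j, p j * Real.log (p j / q j)
  else ∑ j, (q j ^ (β + 1) - (1 + 1 / β) * (q j ^ β * p j) + 1 / β * p j ^ (β + 1))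

/-- The empirical probability vector `(n₁ / N, …, n_{L+1} / N)`, `N = ∑ nⱼ`. -/
def empirical {ι : Type*} [Fintype ι] (n : ι → ℕ) : ι → ℝ := fun j => (n j : ℝ) / ∑ i, (n i : ℝ)

/-- `θ` is a minimum density power divergence estimate for the data `n`. -/
def Design.IsMDPDE (β : ℝ) (n : Fin (L + 1) → ℕ) (θ : Param m) : Prop :=
  θ ∈ paramSpace m ∧
    IsMinOn (fun θ' : Param m => dpd β (empirical n) (S.cellProb θ')) (paramSpace m) θ

/-- `θ` is a maximum likelihood estimate for the data `n` (multinomial log-likelihood). -/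
def Design.IsMLE (n : Fin (L + 1) → ℕ) (θ : Param m) : Prop :=
  θ ∈ paramSpace m ∧
    IsMaxOn (fun θ' : Param m => ∑ j, (n j : ℝ) * Real.log (S.cellProb θ' j)) (paramSpace m) θ

/-- The random vector `n` has the multinomial distribution with `N` trials and cell
probabilities `p`. -/
def IsMultinomial {Ω ι : Type*} [Fintype ι] [MeasurableSpace Ω] (P : Measure Ω) (N : ℕ) (p : ι → ℝ)
    (n : Ω → ι → ℕ) : Prop :=
  AEMeasurable n P ∧ ∀ v : ι → ℕ, ∑ j, v j = N →
    P {ω | n ω = v} = ENNReal.ofReal (Nat.multinomial Finset.univ v * ∏ j, p j ^ v j)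

/-- The partial derivative `∂f/∂θᵢ`. -/
def partialDeriv (f : Param m → ℝ) (θ : Param m) (i : Fin (m + 2)) : ℝ :=
  fderiv ℝ f θ (EuclideanSpace.single i 1)

/-- The Jacobian matrix of the cell probabilities, `W(θ)ⱼᵢ = ∂πⱼ(θ)/∂θᵢ`. -/
def Design.W (θ : Param m) : Matrix (Fin (L + 1)) (Fin (m + 2)) ℝ :=
  Matrix.of fun j i => partialDeriv (fun θ' => S.cellProb θ' j) θ i

/-- The power `D(θ)^r` of the diagonal matrix with diagonal entries `πⱼ(θ)`. -/
def Design.Dpow (θ : Param m) (r : ℝ) : Matrix (Fin (L + 1)) (Fin (L + 1)) ℝ :=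
  Matrix.diagonal fun j => S.cellProb θ j ^ r

/-- `J_β = Wᵀ D^(β-1) W`. -/
def Design.J (β : ℝ) (θ : Param m) : Matrix (Fin (m + 2)) (Fin (m + 2)) ℝ :=
  (S.W θ).transpose * S.Dpow θ (β - 1) * S.W θ

/-- `K_β = Wᵀ (D^(2β-1) - π^β (π^β)ᵀ) W`. -/
def Design.K (β : ℝ) (θ : Param m) : Matrix (Fin (m + 2)) (Fin (m + 2)) ℝ :=
  (S.W θ).transpose *
    (S.Dpow θ (2 * β - 1) -
      Matrix.vecMulVec (fun j => S.cellProb θ j ^ β) (fun j => S.cellProb θ j ^ β)) *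
    S.W θ

/-- `Σ_β = J_β⁻¹ K_β J_β⁻¹`. -/
def Design.asympCov (β : ℝ) (θ : Param m) : Matrix (Fin (m + 2)) (Fin (m + 2)) ℝ :=
  (S.J β θ)⁻¹ * S.K β θ * (S.J β θ)⁻¹

/-- The Fisher information matrix of the model for one device: the expected outer product of the
gradient of the log-likelihood. -/
def Design.fisherInfo (θ : Param m) : Matrix (Fin (m + 2)) (Fin (m + 2)) ℝ :=
  Matrix.of fun a b => ∑ j, S.cellProb θ j *
    (partialDeriv (fun θ' => Real.log (S.cellProb θ' j)) θ a *
      partialDeriv (fun θ' => Real.log (S.cellProb θ' j)) θ b)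

/-- `θ₀` is identified by its cell probabilities within the closed parameter space. -/
def Design.IdentifiableAt (θ₀ : Param m) : Prop :=
  ∀ θ : Param m, (∀ i, 0 ≤ θ i) → S.cellProb θ = S.cellProb θ₀ → θ = θ₀

end StepStress

end

/-!
The estimator is a function of the empirical probability vector `p̂`, and `√N (p̂ - π(θ₀))` is
asymptotically normal, so by the delta method it suffices that this function is differentiable at
`π(θ₀)`, with derivative `T = J_β⁻¹ Wᵀ D^(β-1)`. Near `π(θ₀)` the divergence `d_β(p, π(θ))` is
asymptotically a multiple of the squared norm of `p - π(θ)` with weights `π(θ₀)^(β-1)`. Comparing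
the value at a minimizer with that at `θ₀ + T (p - π(θ₀))`, the minimizer of the linearized least
squares problem, gives the derivative, provided that minimizers near `π(θ₀)` exist and tend to `θ₀`.

They do because `θ` is forced to be close to `θ₀` as soon as `π(θ)` is close to `π(θ₀)`: a limit of
parameters with `π(θ) → π(θ₀)` lies in the closed orthant, where `θ₀` is identified. In the
cumulative exposure model, identifiability and injectivity of `W` both reduce to polynomials of
degree at most `m + 1` that vanish at more than `m + 1` points of one phase; if this is the first
phase, strict log-concavity of `H₀` recovers the remaining parameter `a₁` from the second.
-/

noncomputable section

namespace StepStress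

/-! ### The central limit theorem for multinomial counts -/

section Multinomial

variable {Ω ι : Type*} [Fintype ι] [MeasurableSpace Ω] {P : Measure Ω} {N : ℕ}
  {p : ι → ℝ} {n : Ω → ι → ℕ}

lemma IsMultinomial.map_singleton (h : IsMultinomial P N p n) {v : ι → ℕ} (hv : ∑ j, v j = N) :
    P.map n {v} = ENNReal.ofReal (Nat.multinomial Finset.univ v * ∏ j, p j ^ v j) := by
  rw [Measure.map_apply_of_aemeasurable h.1 (measurableSet_singleton v), ← h.2 v hv]
  rfl

variable [IsProbabilityMeasure P]

lemma IsMultinomial.ae_sum_eq (h : IsMultinomial P N p n) (hp : ∀ j, 0 ≤ p j)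
    (hs : ∑ j, p j = 1) : ∀ᵐ ω ∂P, ∑ j, n ω j = N := by
  classical
  have : IsProbabilityMeasure (P.map n) := Measure.isProbabilityMeasure_map h.1
  suffices hmem : ∀ᵐ v ∂P.map n, v ∈ (Finset.univ.piAntidiag N : Finset (ι → ℕ)) by
    filter_upwards [ae_of_ae_map h.1 hmem] with ω hω
    exact (Finset.mem_piAntidiag.1 hω).1
  refine (mem_ae_iff_prob_eq_one (Finset.measurableSet _)).2 ?_
  calc P.map n (Finset.univ.piAntidiag N : Finset (ι → ℕ))
      = ∑ v ∈ Finset.univ.piAntidiag N,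
          ENNReal.ofReal (Nat.multinomial Finset.univ v * ∏ j, p j ^ v j) := by
        rw [← sum_measure_singleton]
        exact Finset.sum_congr rfl fun v hv => h.map_singleton (Finset.mem_piAntidiag.1 hv).1
    _ = ENNReal.ofReal ((∑ j, p j) ^ N) := by
        rw [Finset.sum_pow_eq_sum_piAntidiag, ENNReal.ofReal_sum_of_nonneg]
        exact fun v _ => mul_nonneg (Nat.cast_nonneg _)
          (Finset.prod_nonneg fun j _ => pow_nonneg (hp j) _)
    _ = 1 := by rw [hs, one_pow, ENNReal.ofReal_one]

lemma IsMultinomial.integral_cexp (h : IsMultinomial P N p n) (hp : ∀ j, 0 ≤ p j)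
    (hs : ∑ j, p j = 1) (t : ι → ℝ) :
    ∫ ω, Complex.exp ((∑ j, t j * n ω j : ℝ) * Complex.I) ∂P
      = (∑ j, p j * Complex.exp (t j * Complex.I)) ^ N := by
  classical
  have : IsProbabilityMeasure (P.map n) := Measure.isProbabilityMeasure_map h.1
  let f : (ι → ℕ) → ℂ := fun v => Complex.exp ((∑ j, t j * v j : ℝ) * Complex.I)
  have hf : AEStronglyMeasurable f (P.map n) := Measurable.of_discrete.aestronglyMeasurable
  have hf_int : Integrable f (P.map n) :=
    .of_bound hf 1 (ae_of_all _ fun v => (Complex.norm_exp_ofReal_mul_I _).le)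
  have hsupp : ∀ᵐ v ∂P.map n, v ∉ (Finset.univ.piAntidiag N : Finset (ι → ℕ)) → f v = 0 := by
    refine (ae_map_iff h.1 (Set.to_countable _).measurableSet).2 ?_
    filter_upwards [h.ae_sum_eq hp hs] with ω hω hmem
    exact absurd (Finset.mem_piAntidiag.2 ⟨hω, fun j _ => Finset.mem_univ j⟩) hmem
  calc ∫ ω, f (n ω) ∂P
      = ∫ v in (Finset.univ.piAntidiag N : Finset (ι → ℕ)), f v ∂P.map n := by
        rw [← integral_map h.1 hf]
        exact (setIntegral_eq_integral_of_ae_compl_eq_zero hsupp).symm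
    _ = ∑ v ∈ Finset.univ.piAntidiag N,
          (Nat.multinomial Finset.univ v * ∏ j, p j ^ v j : ℝ) • f v := by
        rw [setIntegral_finset _ hf_int.integrableOn]
        refine Finset.sum_congr rfl fun v hv => ?_
        have hprod : 0 ≤ ∏ j, p j ^ v j := Finset.prod_nonneg fun j _ => pow_nonneg (hp j) _
        rw [Measure.real, h.map_singleton (Finset.mem_piAntidiag.1 hv).1,
          ENNReal.toReal_ofReal (by positivity)]
    _ = (∑ j, p j * Complex.exp (t j * Complex.I)) ^ N := by
        rw [Finset.sum_pow_eq_sum_piAntidiag]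
        refine Finset.sum_congr rfl fun v _ => ?_
        simp only [f, mul_pow, Finset.prod_mul_distrib, ← Complex.exp_nat_mul, ← Complex.exp_sum,
          Complex.real_smul, Complex.ofReal_sum, Finset.sum_mul]
        push_cast
        rw [mul_assoc]
        congr 4 with j
        ring

end Multinomial

section MultinomialCLT

variable {ι : Type*} [Fintype ι] {p : ι → ℝ}

/-- The covariance matrix `diag p - p pᵀ` of one multinomial trial with cell probabilities `p`. -/
def multinomialCov [DecidableEq ι] (p : ι → ℝ) : Matrix ι ι ℝ :=
  Matrix.diagonal p - Matrix.vecMulVec p p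

lemma dotProduct_multinomialCov_mulVec [DecidableEq ι] (hs : ∑ j, p j = 1) (x : ι → ℝ) :
    x ⬝ᵥ (multinomialCov p).mulVec x = ∑ j, p j * (x j - ∑ i, p i * x i) ^ 2 := by
  set μ := ∑ i, p i * x i with hμ
  have hexpand : ∀ j, p j * (x j - μ) ^ 2 = p j * x j ^ 2 - 2 * μ * (p j * x j) + μ ^ 2 * p j :=
    fun j => by ring
  have hdiag : x ⬝ᵥ (Matrix.diagonal p).mulVec x = ∑ j, p j * x j ^ 2 := by
    simp only [dotProduct, Matrix.mulVec_diagonal]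
    exact Finset.sum_congr rfl fun j _ => by ring
  have hdot : x ⬝ᵥ p = μ := by rw [dotProduct_comm, hμ]; rfl
  simp only [hexpand, Finset.sum_add_distrib, Finset.sum_sub_distrib, ← Finset.mul_sum, hs, ← hμ,
    multinomialCov, Matrix.sub_mulVec, dotProduct_sub, hdiag, Matrix.vecMulVec_mulVec,
    dotProduct_smul, hdot, dotProduct_comm p x, MulOpposite.smul_eq_mul_unop,
    MulOpposite.unop_op]
  ring

lemma posSemidef_multinomialCov [DecidableEq ι] (hp : ∀ j, 0 ≤ p j) (hs : ∑ j, p j = 1) :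
    (multinomialCov p).PosSemidef := by
  refine .of_dotProduct_mulVec_nonneg ?_ fun x => ?_
  · rw [Matrix.IsHermitian, multinomialCov, Matrix.conjTranspose_eq_transpose_of_trivial,
      Matrix.transpose_sub, Matrix.diagonal_transpose, Matrix.transpose_vecMulVec]
  · rw [star_trivial, dotProduct_multinomialCov_mulVec hs]
    exact Finset.sum_nonneg fun j _ => mul_nonneg (hp j) (sq_nonneg _)

lemma isLittleO_cexp_div_sqrt (x : ℝ) :
    (fun N : ℕ => Complex.exp ((x / √N : ℝ) * Complex.I)
        - (1 + (x / √N : ℝ) * Complex.I - x ^ 2 / 2 / N)) =o[atTop] fun N : ℕ => 1 / (N : ℂ) := by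
  have hz : Tendsto (fun N : ℕ => ((x / √N : ℝ) : ℂ) * Complex.I) atTop (𝓝 0) := by
    have hx : Tendsto (fun N : ℕ => x / √(N : ℝ)) atTop (𝓝 0) :=
      tendsto_const_nhds.div_atTop (Real.tendsto_sqrt_atTop.comp tendsto_natCast_atTop_atTop)
    simpa using (Complex.continuous_ofReal.tendsto 0).comp hx |>.mul_const Complex.I
  have hsq : ∀ N : ℕ, ((x / √N : ℝ) * Complex.I) ^ 2 = -(x : ℂ) ^ 2 * (1 / N) := fun N => by
    rw [mul_pow, Complex.I_sq, ← Complex.ofReal_pow, div_pow, Real.sq_sqrt (Nat.cast_nonneg N)]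
    push_cast
    ring
  have htaylor := (Complex.exp_sub_sum_range_succ_isLittleO_pow 2).comp_tendsto hz
  simp only [Function.comp_def, hsq, Finset.sum_range_succ, Finset.sum_range_zero] at htaylor
  refine (htaylor.trans_isBigO (Asymptotics.isBigO_const_mul_self _ _ _)).congr_left fun N => ?_
  simp only [pow_zero, pow_one, Nat.factorial]
  push_cast
  ring

lemma tendsto_sum_cexp_pow {x : ι → ℝ} (hs : ∑ j, p j = 1) (hx : ∑ j, p j * x j = 0) :
    Tendsto (fun N : ℕ => (∑ j, (p j : ℂ) * Complex.exp ((x j / √N : ℝ) * Complex.I)) ^ N) atTop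
      (𝓝 (Complex.exp (-(∑ j, p j * x j ^ 2 : ℝ) / 2))) := by
  refine Complex.tendsto_pow_exp_of_isLittleO_sub_add_div _ ?_
  refine (Asymptotics.IsLittleO.fun_sum (s := Finset.univ) fun j _ =>
    (isLittleO_cexp_div_sqrt (x j)).const_mul_left (p j : ℂ)).congr_left fun N => ?_
  have hs' : ∑ j, (p j : ℂ) = 1 := by exact_mod_cast hs
  have hx' : ∑ j, (p j : ℂ) * ((x j / √N : ℝ) * Complex.I) = 0 := by
    have : ∑ j, (p j : ℂ) * x j = 0 := by exact_mod_cast hx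
    calc _ = (∑ j, (p j : ℂ) * x j) * (((√N : ℝ) : ℂ)⁻¹ * Complex.I) := by
          rw [Finset.sum_mul]
          exact Finset.sum_congr rfl fun j _ => by push_cast; ring
      _ = 0 := by rw [this, zero_mul]
  have hvar : ∑ j, (p j : ℂ) * ((x j : ℂ) ^ 2 / 2 / N)
      = ((∑ j, p j * x j ^ 2 : ℝ) : ℂ) / 2 / N := by
    push_cast
    simp only [Finset.sum_div, mul_div_assoc]
  simp only [mul_sub, mul_add, mul_one, Finset.sum_sub_distrib, Finset.sum_add_distrib, hs', hx',
    hvar]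
  ring

/-- The estimation error `p̂ - p` of the empirical probability vector of the counts `v`. -/
def empiricalError (p : ι → ℝ) (v : ι → ℕ) : EuclideanSpace ℝ ι :=
  WithLp.toLp 2 (empirical v - p)

lemma IsMultinomial.aemeasurable_smul_empiricalError {Ω : Type*} [MeasurableSpace Ω]
    {P : Measure Ω} {N : ℕ} {n : Ω → ι → ℕ} (h : IsMultinomial P N p n) (c : ℝ) :
    AEMeasurable (fun ω => c • empiricalError p (n ω)) P :=
  (Measurable.of_discrete (f := fun v => c • empiricalError p v)).comp_aemeasurable h.1

lemma inner_sqrt_smul_empiricalError {N : ℕ} {v : ι → ℕ} (hv : ∑ j, v j = N)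
    (t : EuclideanSpace ℝ ι) :
    inner ℝ (√(N : ℝ) • empiricalError p v) t
      = ∑ j, (t j - ∑ i, p i * t i) / √N * v j := by
  have hv' : ∑ j, (v j : ℝ) = N := by exact_mod_cast hv
  calc inner ℝ (√(N : ℝ) • empiricalError p v) t
      = √N * (∑ j, t j * v j / N - ∑ j, p j * t j) := by
        rw [real_inner_smul_left, PiLp.inner_apply, ← Finset.sum_sub_distrib]
        refine congrArg _ (Finset.sum_congr rfl fun j _ => ?_)
        simp only [empiricalError, empirical, hv', Pi.sub_apply, RCLike.inner_apply, conj_trivial]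
        ring
    _ = (∑ j, t j * v j - (∑ i, p i * t i) * N) / √N := by
        rw [← Finset.sum_div]
        rcases N.eq_zero_or_pos with rfl | hN
        · simp
        · have hN' : (0 : ℝ) < N := by exact_mod_cast hN
          field_simp
          rw [Real.sq_sqrt hN'.le]
    _ = ∑ j, (t j - ∑ i, p i * t i) / √N * v j := by
        rw [← hv', Finset.mul_sum, ← Finset.sum_sub_distrib, Finset.sum_div]
        exact Finset.sum_congr rfl fun j _ => by ring

lemma IsMultinomial.charFun_sqrt_smul_empiricalError {Ω : Type*} [MeasurableSpace Ω]
    {P : Measure Ω} [IsProbabilityMeasure P] {N : ℕ} {n : Ω → ι → ℕ}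
    (h : IsMultinomial P N p n) (hp : ∀ j, 0 ≤ p j) (hs : ∑ j, p j = 1)
    (t : EuclideanSpace ℝ ι) :
    charFun (P.map fun ω => √(N : ℝ) • empiricalError p (n ω)) t =
      (∑ j, (p j : ℂ) * Complex.exp (((t j - ∑ i, p i * t i) / √N : ℝ) * Complex.I)) ^ N := by
  rw [charFun_apply, integral_map (h.aemeasurable_smul_empiricalError _)
    (Measurable.aestronglyMeasurable (by fun_prop)), ← h.integral_cexp hp hs]
  refine integral_congr_ae ?_
  filter_upwards [h.ae_sum_eq hp hs] with ω hω
  rw [inner_sqrt_smul_empiricalError hω]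

theorem IsMultinomial.tendstoInDistribution_empiricalError [DecidableEq ι] {Ω : ℕ → Type*}
    [∀ N, MeasurableSpace (Ω N)] {P : (N : ℕ) → Measure (Ω N)} [∀ N, IsProbabilityMeasure (P N)]
    {n : (N : ℕ) → Ω N → ι → ℕ} (h : ∀ N, IsMultinomial (P N) N p (n N)) (hp : ∀ j, 0 ≤ p j)
    (hs : ∑ j, p j = 1) :
    TendstoInDistribution (fun (N : ℕ) ω => √(N : ℝ) • empiricalError p (n N ω)) atTop id P
      (multivariateGaussian 0 (multinomialCov p)) := by
  refine ⟨fun N => (h N).aemeasurable_smul_empiricalError _, aemeasurable_id, ?_⟩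
  refine ProbabilityMeasure.tendsto_iff_tendsto_charFun.2 fun t => ?_
  have hmean : ∑ j, p j * (t j - ∑ i, p i * t i) = 0 := by
    simp only [mul_sub, Finset.sum_sub_distrib, ← Finset.sum_mul, hs, one_mul, sub_self]
  simpa only [ProbabilityMeasure.coe_mk, Measure.map_id,
    charFun_multivariateGaussian (posSemidef_multinomialCov hp hs),
    dotProduct_multinomialCov_mulVec hs, inner_zero_right, Complex.ofReal_zero, zero_mul, zero_sub,
    neg_div, (h _).charFun_sqrt_smul_empiricalError hp hs] using tendsto_sum_cexp_pow hs hmean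

end MultinomialCLT

/-! ### Slutsky's theorem and the delta method on varying probability spaces -/

section DeltaMethod

variable {ι : Type*} {l : Filter ι} {Ω : ι → Type*} [∀ i, MeasurableSpace (Ω i)]
  {P : (i : ι) → Measure (Ω i)} [∀ i, IsProbabilityMeasure (P i)]
  {Ω' : Type*} [MeasurableSpace Ω'] {μ' : Measure Ω'} [IsProbabilityMeasure μ']
  {E : Type*} [NormedAddCommGroup E] [MeasurableSpace E] [BorelSpace E]

lemma tendstoInDistribution_infinitePi_iff {X : (i : ι) → Ω i → E} {Z : Ω' → E}
    (hX : ∀ i, AEMeasurable (X i) (P i)) :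
    TendstoInDistribution (fun i (ω : ∀ i, Ω i) => X i (ω i)) l Z
        (fun _ => Measure.infinitePi P) μ' ↔
      TendstoInDistribution X l Z P μ' := by
  have hmap : ∀ i, (Measure.infinitePi P).map (fun ω => X i (ω i)) = (P i).map (X i) := fun i => by
    have heval := measurePreserving_eval_infinitePi P i
    rw [← heval.map_eq, AEMeasurable.map_map_of_aemeasurable (heval.map_eq ▸ hX i)
      heval.measurable.aemeasurable]
    rfl
  constructor
  · refine fun h => ⟨hX, h.aemeasurable_limit, ?_⟩
    simpa only [hmap] using h.tendsto
  · refine fun h => ⟨fun i => (hX i).comp_quasiMeasurePreserving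
      (measurePreserving_eval_infinitePi P i).quasiMeasurePreserving, h.aemeasurable_limit, ?_⟩
    simpa only [hmap] using h.tendsto

/-- Convergence in distribution only depends on the individual laws, so the variables may be
transported to the product of the probability spaces, where Slutsky's theorem is available. -/
lemma tendstoInDistribution_of_tendsto_measure_norm_sub [SecondCountableTopology E]
    [l.IsCountablyGenerated] {X Y : (i : ι) → Ω i → E} {Z : Ω' → E}
    (hX : TendstoInDistribution X l Z P μ') (hY : ∀ i, AEMeasurable (Y i) (P i))
    (hXY : ∀ η > 0, Tendsto (fun i => P i {ω | η ≤ ‖Y i ω - X i ω‖}) l (𝓝 0)) :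
    TendstoInDistribution Y l Z P μ' := by
  have hX' := hX.forall_aemeasurable
  refine (tendstoInDistribution_infinitePi_iff hY).1
    (tendstoInDistribution_of_tendstoInMeasure_sub _ _
      ((tendstoInDistribution_infinitePi_iff hX').2 hX) ?_
      fun i => (hY i).comp_quasiMeasurePreserving
        (measurePreserving_eval_infinitePi P i).quasiMeasurePreserving)
  refine tendstoInMeasure_iff_norm.2 fun η hη => (hXY η hη).congr fun i => ?_
  simp only [Pi.sub_apply, Pi.zero_apply, sub_zero]
  exact ((measurePreserving_eval_infinitePi P i).measure_preimage
    (nullMeasurableSet_le aemeasurable_const ((hY i).sub (hX' i)).norm)).symm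

lemma exists_eventually_measure_norm_ge_lt {X : (i : ι) → Ω i → E} {Z : Ω' → E}
    (hX : TendstoInDistribution X l Z P μ') {ε : ENNReal} (hε : 0 < ε) :
    ∃ M : ℝ, 0 < M ∧ ∀ᶠ i in l, P i {ω | M ≤ ‖X i ω‖} < ε := by
  have hclosed : ∀ M : ℝ, IsClosed {x : E | M ≤ ‖x‖} := fun M =>
    isClosed_le continuous_const continuous_norm
  have htail : Tendsto (fun M : ℝ => μ'.map Z {x | M ≤ ‖x‖}) atTop (𝓝 0) := by
    have := tendsto_measure_iInter_atTop (μ := μ'.map Z) (s := fun M : ℝ => {x : E | M ≤ ‖x‖})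
      (fun M => (hclosed M).measurableSet.nullMeasurableSet) (fun a b hab x hx => hab.trans hx)
      ⟨0, measure_ne_top _ _⟩
    rwa [Set.iInter_eq_empty_iff.2 fun x : E => ⟨‖x‖ + 1, (lt_add_one ‖x‖).not_ge⟩,
      measure_empty] at this
  obtain ⟨M, hMε, hM⟩ := ((htail.eventually_lt_const hε).and (eventually_gt_atTop 0)).exists
  refine ⟨M, hM, ?_⟩
  have hlimsup := (ProbabilityMeasure.limsup_measure_closed_le_of_tendsto hX.tendsto
    (hclosed M)).trans_lt hMε
  filter_upwards [eventually_lt_of_limsup_lt hlimsup] with i hi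
  rwa [ProbabilityMeasure.coe_mk, Measure.map_apply_of_aemeasurable (hX.forall_aemeasurable i)
    (hclosed M).measurableSet] at hi

variable [NormedSpace ℝ E] {F : Type*} [NormedAddCommGroup F] [NormedSpace ℝ F]
  [MeasurableSpace F] [BorelSpace F] [SecondCountableTopology F]

/-- The delta method. The estimators `Y i` need not be functions of the `U i`; it is enough that
they are linear in `U i` up to an error of smaller order wherever `U i` is small. -/
theorem tendstoInDistribution_delta_method [l.IsCountablyGenerated]
    {U : (i : ι) → Ω i → E} {Z : Ω' → E} {r : ι → ℝ} (hr : Tendsto r l atTop)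
    (hU : TendstoInDistribution (fun i ω => r i • U i ω) l Z P μ') (T : E →L[ℝ] F)
    {Y : (i : ι) → Ω i → F} {y : F} (hY : ∀ i, AEMeasurable (Y i) (P i))
    (happrox : ∀ ε > 0, ∃ δ > 0, ∀ᶠ i in l, ∀ᵐ ω ∂P i,
      ‖U i ω‖ < δ → ‖Y i ω - y - T (U i ω)‖ ≤ ε * ‖U i ω‖) :
    TendstoInDistribution (fun i ω => r i • (Y i ω - y)) l (T ∘ Z) P μ' := by
  refine tendstoInDistribution_of_tendsto_measure_norm_sub (hU.continuous_comp T.continuous)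
    (fun i => ((hY i).sub_const y).fun_const_smul _) fun η hη => ?_
  refine ENNReal.tendsto_nhds_zero.2 fun ε hε => ?_
  obtain ⟨M, hM, hUM⟩ := exists_eventually_measure_norm_ge_lt hU hε
  obtain ⟨δ, hδ, hYδ⟩ := happrox (η / (2 * M)) (by positivity)
  filter_upwards [hUM, hYδ, hr.eventually_ge_atTop (M / δ), hr.eventually_gt_atTop 0]
    with i hUi hYi hri hri0
  refine (measure_mono_ae ?_).trans hUi.le
  filter_upwards [hYi] with ω hω (hdiff : η ≤ ‖r i • (Y i ω - y) - T (r i • U i ω)‖)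
  change M ≤ ‖r i • U i ω‖
  by_contra! hlt
  rw [norm_smul, Real.norm_of_nonneg hri0.le] at hlt
  have hsmall : ‖U i ω‖ < δ := by
    have hδr : M ≤ r i * δ := (div_le_iff₀ hδ).1 hri
    exact lt_of_mul_lt_mul_left (hlt.trans_le hδr) hri0.le
  have hcontra : ‖r i • (Y i ω - y) - T (r i • U i ω)‖ < η :=
    calc ‖r i • (Y i ω - y) - T (r i • U i ω)‖
        = r i * ‖Y i ω - y - T (U i ω)‖ := by
          rw [map_smul, ← smul_sub, norm_smul, Real.norm_of_nonneg hri0.le]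
      _ ≤ r i * (η / (2 * M) * ‖U i ω‖) := by gcongr; exact hω hsmall
      _ = η / (2 * M) * (r i * ‖U i ω‖) := by ring
      _ ≤ η / (2 * M) * M := by gcongr
      _ < η := by field_simp; linarith
  exact hcontra.not_ge hdiff

end DeltaMethod

/-- The continuous linear map between Euclidean spaces with matrix `A`. -/
def matrixCLM {ι κ : Type*} [Fintype ι] [Fintype κ] [DecidableEq ι] (A : Matrix κ ι ℝ) :
    EuclideanSpace ℝ ι →L[ℝ] EuclideanSpace ℝ κ :=
  (Matrix.toLpLin 2 2 A).toContinuousLinearMap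

lemma matrixCLM_apply {ι κ : Type*} [Fintype ι] [Fintype κ] [DecidableEq ι] (A : Matrix κ ι ℝ)
    (x : EuclideanSpace ℝ ι) : (matrixCLM A x).ofLp = A.mulVec x.ofLp := rfl

lemma multivariateGaussian_map_matrixCLM {ι κ : Type*} [Fintype ι] [Fintype κ] [DecidableEq ι]
    [DecidableEq κ] (A : Matrix κ ι ℝ) {C : Matrix ι ι ℝ} (hC : C.PosSemidef) :
    (multivariateGaussian 0 C).map (matrixCLM A)
      = multivariateGaussian 0 (A * C * A.transpose) := by
  have hACA : (A * C * A.transpose).PosSemidef := by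
    simpa only [Matrix.conjTranspose_eq_transpose_of_trivial] using hC.mul_mul_conjTranspose_same A
  have hadj : ∀ (x : EuclideanSpace ℝ ι) (t : EuclideanSpace ℝ κ),
      inner ℝ (matrixCLM A x) t = inner ℝ x (matrixCLM A.transpose t) := fun x t => by
    simp only [EuclideanSpace.inner_eq_star_dotProduct, star_trivial, matrixCLM_apply,
      Matrix.dotProduct_mulVec, Matrix.mulVec_transpose]
  refine Measure.ext_of_charFun (funext fun t => ?_)
  have hcomp : charFun ((multivariateGaussian 0 C).map (matrixCLM A)) t
      = charFun (multivariateGaussian 0 C) (matrixCLM A.transpose t) := by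
    rw [charFun_apply, charFun_apply, integral_map (matrixCLM A).continuous.measurable.aemeasurable
      (Measurable.aestronglyMeasurable (by fun_prop))]
    simp only [hadj]
  rw [hcomp, charFun_multivariateGaussian hC, charFun_multivariateGaussian hACA, inner_zero_right,
    inner_zero_right, matrixCLM_apply, ← Matrix.mulVec_mulVec, ← Matrix.mulVec_mulVec,
    Matrix.dotProduct_mulVec t.ofLp A, Matrix.mulVec_transpose]

/-! ### The density power divergence -/

/-- One term of the density power divergence. At `β = 0` the summand `q - p`, which cancels in the
divergence of probability vectors, is added to make the term nonnegative. -/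
def dpdTerm (β p q : ℝ) : ℝ :=
  if β = 0 then p * Real.log (p / q) - p + q
  else q ^ (β + 1) - (1 + 1 / β) * (q ^ β * p) + 1 / β * p ^ (β + 1)

lemma dpd_eq_sum_dpdTerm {ι : Type*} [Fintype ι] (β : ℝ) {p q : ι → ℝ}
    (h : ∑ j, p j = ∑ j, q j) : dpd β p q = ∑ j, dpdTerm β (p j) (q j) := by
  unfold dpd dpdTerm
  split_ifs with hβ
  · rw [Finset.sum_add_distrib, Finset.sum_sub_distrib, h, sub_add_cancel]
  · rfl

lemma dpdTerm_self {β p : ℝ} (hp : 0 < p) : dpdTerm β p p = 0 := by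
  unfold dpdTerm
  split_ifs with hβ
  · rw [div_self hp.ne', Real.log_one]; ring
  · rw [Real.rpow_add hp, Real.rpow_one]; ring

lemma hasDerivAt_dpdTerm_zero {p q : ℝ} (hp : 0 < p) (hq : 0 < q) :
    HasDerivAt (dpdTerm 0 p) (q⁻¹ * (q - p)) q := by
  have hderiv : HasDerivAt (fun x : ℝ => p * (Real.log p - Real.log x) - p + x)
      (p * (0 - q⁻¹) - 0 + 1) q :=
    ((((hasDerivAt_const q (Real.log p)).sub (Real.hasDerivAt_log hq.ne')).const_mul p).sub
      (hasDerivAt_const q p)).add (hasDerivAt_id q)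
  have heq : dpdTerm 0 p =ᶠ[𝓝 q] fun x : ℝ => p * (Real.log p - Real.log x) - p + x := by
    filter_upwards [lt_mem_nhds hq] with x hx
    simp [dpdTerm, Real.log_div hp.ne' hx.ne']
  have hval : q⁻¹ * (q - p) = p * (0 - q⁻¹) - 0 + 1 := by
    field_simp
    ring
  exact hval ▸ hderiv.congr_of_eventuallyEq heq

lemma hasDerivAt_dpdTerm_of_ne_zero {β q : ℝ} (hβ : β ≠ 0) (p : ℝ) (hq : 0 < q) :
    HasDerivAt (dpdTerm β p) ((β + 1) * q ^ (β - 1) * (q - p)) q := by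
  have hderiv : HasDerivAt (dpdTerm β p)
      ((β + 1) * q ^ (β + 1 - 1) - (1 + 1 / β) * (β * q ^ (β - 1) * p)) q := by
    unfold dpdTerm
    simp only [if_neg hβ]
    exact ((Real.hasDerivAt_rpow_const (Or.inl hq.ne')).sub
      (((Real.hasDerivAt_rpow_const (Or.inl hq.ne')).mul_const p).const_mul _)).add_const _
  have hpow : q ^ (β + 1 - 1) = q ^ (β - 1) * q := by
    rw [← Real.rpow_add_one hq.ne']; ring_nf
  have hval : (β + 1) * q ^ (β - 1) * (q - p)
      = (β + 1) * q ^ (β + 1 - 1) - (1 + 1 / β) * (β * q ^ (β - 1) * p) := by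
    rw [hpow]
    field_simp
  exact hval ▸ hderiv

lemma hasDerivAt_dpdTerm {β p q : ℝ} (hp : 0 < p) (hq : 0 < q) :
    HasDerivAt (dpdTerm β p) ((β + 1) * q ^ (β - 1) * (q - p)) q := by
  rcases eq_or_ne β 0 with rfl | hβ
  · simpa [Real.rpow_neg_one] using hasDerivAt_dpdTerm_zero hp hq
  · exact hasDerivAt_dpdTerm_of_ne_zero hβ p hq

lemma dpdTerm_antitoneOn {β p : ℝ} (hβ : 0 ≤ β) (hp : 0 < p) :
    AntitoneOn (dpdTerm β p) (Set.Ioc 0 p) := by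
  refine antitoneOn_of_hasDerivWithinAt_nonpos (convex_Ioc 0 p)
    (fun q hq => (hasDerivAt_dpdTerm hp hq.1).continuousAt.continuousWithinAt)
    (fun q hq => (hasDerivAt_dpdTerm hp (interior_subset hq).1).hasDerivWithinAt) fun q hq => ?_
  obtain ⟨hq0, hqp⟩ := interior_subset hq
  exact mul_nonpos_of_nonneg_of_nonpos (by positivity) (by linarith)

lemma dpdTerm_monotoneOn {β p : ℝ} (hβ : 0 ≤ β) (hp : 0 < p) :
    MonotoneOn (dpdTerm β p) (Set.Ici p) := by
  refine monotoneOn_of_hasDerivWithinAt_nonneg (convex_Ici p)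
    (fun q hq => (hasDerivAt_dpdTerm hp (hp.trans_le hq)).continuousAt.continuousWithinAt)
    (fun q hq => (hasDerivAt_dpdTerm hp (hp.trans_le (interior_subset hq))).hasDerivWithinAt)
    fun q hq => ?_
  have hpq : p ≤ q := interior_subset hq
  have hq0 : 0 < q := hp.trans_le hpq
  exact mul_nonneg (by positivity) (by linarith)

lemma dpdTerm_le_of_mem_uIcc {β p q s : ℝ} (hβ : 0 ≤ β) (hp : 0 < p) (hq : 0 < q)
    (hs : s ∈ Set.uIcc p q) : dpdTerm β p s ≤ dpdTerm β p q := by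
  rcases Set.mem_uIcc.1 hs with ⟨hps, hsq⟩ | ⟨hqs, hsp⟩
  · exact dpdTerm_monotoneOn hβ hp hps (hps.trans hsq) hsq
  · exact dpdTerm_antitoneOn hβ hp ⟨hq, hqs.trans hsp⟩ ⟨hq.trans_le hqs, hsp⟩ hqs

lemma dpdTerm_nonneg {β p q : ℝ} (hβ : 0 ≤ β) (hp : 0 < p) (hq : 0 < q) : 0 ≤ dpdTerm β p q :=
  (dpdTerm_self hp).ge.trans (dpdTerm_le_of_mem_uIcc hβ hp hq Set.left_mem_uIcc)

lemma abs_sub_sub_half_mul_sq_le {f w : ℝ → ℝ} {p q w₀ ε : ℝ}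
    (hf : ∀ x ∈ Set.uIcc p q, HasDerivAt f (w x * (x - p)) x)
    (hw : ∀ x ∈ Set.uIcc p q, |w x - w₀| ≤ ε) :
    |f q - f p - w₀ / 2 * (q - p) ^ 2| ≤ ε * (q - p) ^ 2 := by
  have hderiv : ∀ x ∈ Set.uIcc p q, HasDerivWithinAt (fun x => f x - w₀ / 2 * (x - p) ^ 2)
      ((w x - w₀) * (x - p)) (Set.uIcc p q) x := by
    intro x hx
    have hsq : HasDerivAt (fun x : ℝ => (x - p) ^ 2) (2 * (x - p)) x := by
      simpa using ((hasDerivAt_id x).sub_const p).fun_pow 2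
    have hval : (w x - w₀) * (x - p) = w x * (x - p) - w₀ / 2 * (2 * (x - p)) := by ring
    exact hval ▸ ((hf x hx).sub (hsq.const_mul (w₀ / 2))).hasDerivWithinAt
  have hbound : ∀ x ∈ Set.uIcc p q, ‖(w x - w₀) * (x - p)‖ ≤ ε * |q - p| := by
    intro x hx
    rw [norm_mul]
    have hε : 0 ≤ ε := (abs_nonneg _).trans (hw x hx)
    gcongr
    · exact hw x hx
    · exact Set.abs_sub_left_of_mem_uIcc hx
  have hmv := (convex_uIcc p q).norm_image_sub_le_of_norm_hasDerivWithin_le hderiv hbound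
    Set.left_mem_uIcc Set.right_mem_uIcc
  calc |f q - f p - w₀ / 2 * (q - p) ^ 2|
      = ‖(f q - w₀ / 2 * (q - p) ^ 2) - (f p - w₀ / 2 * (p - p) ^ 2)‖ := by
        rw [Real.norm_eq_abs]; ring_nf
    _ ≤ ε * |q - p| * |q - p| := hmv
    _ = ε * (q - p) ^ 2 := by rw [mul_assoc, abs_mul_abs_self, sq]

lemma exists_dpdTerm_expansion (β : ℝ) {r ε : ℝ} (hr : 0 < r) (hε : 0 < ε) :
    ∃ δ > 0, ∀ p q : ℝ, |p - r| < δ → |q - r| < δ →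
      |dpdTerm β p q - (β + 1) / 2 * r ^ (β - 1) * (q - p) ^ 2| ≤ ε * (q - p) ^ 2 := by
  have hcont : ContinuousAt (fun q : ℝ => (β + 1) * q ^ (β - 1)) r :=
    (Real.continuousAt_rpow_const r (β - 1) (Or.inl hr.ne')).const_mul _
  obtain ⟨δ, hδ, hclose⟩ := Metric.eventually_nhds_iff_ball.1
    ((lt_mem_nhds hr).and (Metric.tendsto_nhds.1 hcont ε hε))
  refine ⟨δ, hδ, fun p q hp hq => ?_⟩
  have hseg : Set.uIcc p q ⊆ Metric.ball r δ := by
    rw [← segment_eq_uIcc]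
    exact (convex_ball r δ).segment_subset hp hq
  have hexp := abs_sub_sub_half_mul_sq_le
    (fun x hx => hasDerivAt_dpdTerm (hclose p hp).1 (hclose x (hseg hx)).1)
    (fun x hx => (hclose x (hseg hx)).2.le)
  rw [dpdTerm_self (hclose p hp).1, sub_zero] at hexp
  rwa [div_mul_eq_mul_div]

lemma exists_eventually_le_dpdTerm {β r ε : ℝ} (hβ : 0 ≤ β) (hr : 0 < r) (hε : 0 < ε) :
    ∃ c > 0, ∀ᶠ p in 𝓝 r, ∀ q, 0 < q → ε ≤ |q - r| → c ≤ dpdTerm β p q := by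
  set A : ℝ := (β + 1) / 2 * r ^ (β - 1) with hA
  have hA0 : 0 < A := by positivity
  obtain ⟨δ, hδ, hexp⟩ := exists_dpdTerm_expansion β hr (half_pos hA0)
  obtain ⟨s, hs0, hs⟩ := exists_between (lt_min hε (lt_min hδ hr))
  obtain ⟨hsε, hsδ, hsr⟩ := by simpa only [lt_min_iff] using hs
  refine ⟨A / 2 * (s / 2) ^ 2, by positivity, ?_⟩
  filter_upwards [Metric.ball_mem_nhds r (half_pos hs0)] with p hp q hq hqr
  obtain ⟨hp1, hp2⟩ := abs_lt.1 (Metric.mem_ball.1 hp)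
  have hbound : ∀ q', |q' - r| = s → s / 2 ≤ |q' - p| → A / 2 * (s / 2) ^ 2 ≤ dpdTerm β p q' := by
    intro q' hq' hqp
    have hlow := (abs_le.1 (hexp p q' ((Metric.mem_ball.1 hp).trans (by linarith))
      (hq'.trans_lt hsδ))).1
    have hsq : (s / 2) ^ 2 ≤ (q' - p) ^ 2 := by
      rw [← sq_abs (q' - p)]
      gcongr
    rw [← hA] at hlow
    nlinarith
  rcases le_abs.1 (hsε.le.trans hqr) with hle | hle
  · refine (hbound (r + s) (by rw [add_sub_cancel_left, abs_of_pos hs0]) ?_).trans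
      (dpdTerm_le_of_mem_uIcc hβ (by linarith) hq (Set.mem_uIcc.2 (.inl ?_)))
    · exact le_trans (by linarith) (le_abs_self _)
    · constructor <;> linarith
  · refine (hbound (r - s) (by rw [sub_sub_cancel_left, abs_neg, abs_of_pos hs0]) ?_).trans
      (dpdTerm_le_of_mem_uIcc hβ (by linarith) hq (Set.mem_uIcc.2 (.inr ?_)))
    · exact le_trans (by linarith) (neg_le_abs _)
    · constructor <;> linarith

lemma continuousAt_dpdTerm_left {β q : ℝ} (hq : 0 < q) :
    ContinuousAt (fun p => dpdTerm β p q) q := by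
  unfold dpdTerm
  split_ifs
  · have hlog : ContinuousAt (fun p => Real.log (p / q)) q :=
      ContinuousAt.log (by fun_prop) (div_self hq.ne' ▸ one_ne_zero)
    fun_prop
  · have hpow : ContinuousAt (fun p : ℝ => p ^ (β + 1)) q :=
      Real.continuousAt_rpow_const _ _ (.inl hq.ne')
    fun_prop

lemma eventually_mem_of_dpd_le {ι : Type*} [Fintype ι] {β : ℝ} (hβ : 0 ≤ β) {r : ι → ℝ}
    (hr : ∀ j, 0 < r j) (hr1 : ∑ j, r j = 1) {U : Set (ι → ℝ)} (hU : U ∈ 𝓝 r) :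
    ∀ᶠ p in 𝓝 r, ∑ j, p j = 1 → ∀ q : ι → ℝ, (∀ j, 0 < q j) → ∑ j, q j = 1 →
      dpd β p q ≤ dpd β p r → q ∈ U := by
  obtain ⟨ε, hε, hball⟩ := Metric.mem_nhds_iff.1 hU
  choose c hc hlow using fun j => exists_eventually_le_dpdTerm hβ (hr j) hε
  have hlim : Tendsto (fun p : ι → ℝ => ∑ j, dpdTerm β (p j) (r j)) (𝓝 r) (𝓝 0) := by
    have hterm : ∀ j, Tendsto (fun p : ι → ℝ => dpdTerm β (p j) (r j)) (𝓝 r) (𝓝 0) := fun j =>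
      dpdTerm_self (β := β) (hr j) ▸
        (continuousAt_dpdTerm_left (hr j)).tendsto.comp ((continuous_apply j).tendsto r)
    simpa using tendsto_finsetSum Finset.univ fun j _ => hterm j
  have hsmall : ∀ᶠ p in 𝓝 r, ∀ j, ∑ i, dpdTerm β (p i) (r i) < c j :=
    eventually_all.2 fun j => hlim.eventually (gt_mem_nhds (hc j))
  have hcoord : ∀ᶠ p in 𝓝 r, ∀ j, 0 < p j ∧
      ∀ q, 0 < q → ε ≤ |q - r j| → c j ≤ dpdTerm β (p j) q := eventually_all.2 fun j =>
    ((continuous_apply j).tendsto r).eventually ((lt_mem_nhds (hr j)).and (hlow j))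
  filter_upwards [hsmall, hcoord] with p hps hpc hp q hq hq1 hle
  refine hball ((dist_pi_lt_iff hε).2 fun j => ?_)
  rw [dpd_eq_sum_dpdTerm β (hp.trans hq1.symm), dpd_eq_sum_dpdTerm β (hp.trans hr1.symm)] at hle
  by_contra hfar
  refine (hps j).not_ge ?_
  calc c j ≤ dpdTerm β (p j) (q j) := (hpc j).2 (q j) (hq j) (not_lt.1 hfar)
    _ ≤ ∑ i, dpdTerm β (p i) (q i) :=
      Finset.single_le_sum (f := fun i => dpdTerm β (p i) (q i))
        (fun i _ => dpdTerm_nonneg hβ (hpc i).1 (hq i)) (Finset.mem_univ j)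
    _ ≤ ∑ i, dpdTerm β (p i) (r i) := hle

lemma continuousOn_sum_dpdTerm {ι : Type*} [Fintype ι] (β : ℝ) {p : ι → ℝ} (hp : ∀ j, 0 < p j) :
    ContinuousOn (fun q : ι → ℝ => ∑ j, dpdTerm β (p j) (q j)) {q | ∀ j, 0 < q j} := by
  refine continuousOn_finsetSum _ fun j _ q hq => ContinuousAt.continuousWithinAt ?_
  exact ContinuousAt.comp' (f := fun q : ι → ℝ => q j)
    (hasDerivAt_dpdTerm (hp j) (hq j)).continuousAt (continuous_apply j).continuousAt

/-! ### Differentiability of the minimum distance functional -/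

section LeastSquares

open Asymptotics

variable {κ E F G : Type*} [NormedAddCommGroup E] [NormedSpace ℝ E] [NormedAddCommGroup F]
  [NormedAddCommGroup G] {l : Filter κ}

lemma isLittleO_norm_sq_sub_norm_sq {u v : κ → F} {g : κ → G}
    (h : (fun i => u i - v i) =o[l] g) (hv : v =O[l] g) :
    (fun i => ‖u i‖ ^ 2 - ‖v i‖ ^ 2) =o[l] fun i => ‖g i‖ ^ 2 := by
  have hu : u =O[l] g := (h.isBigO.add hv).congr_left fun i => sub_add_cancel _ _
  have hsub : (fun i => ‖u i‖ - ‖v i‖) =o[l] fun i => ‖g i‖ :=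
    ((IsBigO.of_bound' (.of_forall fun i => abs_norm_sub_norm_le (u i) (v i))).trans_isLittleO
      h).norm_right
  have hadd : (fun i => ‖u i‖ + ‖v i‖) =O[l] fun i => ‖g i‖ := (hu.norm_norm).add hv.norm_norm
  exact (hsub.mul_isBigO hadd).congr (fun i => by ring) fun i => by ring

lemma eventually_norm_sq_le_mul_norm_sq {u v : κ → F} {a b : κ → ℝ}
    (ha : a ~[l] fun i => ‖u i‖ ^ 2) (hb : b ~[l] fun i => ‖v i‖ ^ 2) (hab : a ≤ᶠ[l] b)
    {c : ℝ} (hc : 1 < c) : ∀ᶠ i in l, ‖u i‖ ^ 2 ≤ c * ‖v i‖ ^ 2 := by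
  have hδ : 0 < (c - 1) / (c + 1) := div_pos (by linarith) (by linarith)
  filter_upwards [ha.isLittleO.def hδ, hb.isLittleO.def hδ, hab] with i hai hbi habi
  simp only [Pi.sub_apply, Real.norm_eq_abs, abs_sq] at hai hbi
  have hlow : 2 / (c + 1) * ‖u i‖ ^ 2 ≤ a i := by
    have hcoef : 2 / (c + 1) = 1 - (c - 1) / (c + 1) := by
      field_simp
      ring
    rw [hcoef]
    linarith [(abs_le.1 hai).1]
  have hupp : b i ≤ 2 / (c + 1) * (c * ‖v i‖ ^ 2) := by
    have hcoef : 2 / (c + 1) * (c * ‖v i‖ ^ 2) = (1 + (c - 1) / (c + 1)) * ‖v i‖ ^ 2 := by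
      field_simp
      ring
    rw [hcoef]
    linarith [(abs_le.1 hbi).2]
  exact le_of_mul_le_mul_left (hlow.trans (habi.trans hupp)) (by positivity)

lemma eventually_norm_sq_sub_norm_sq_le {u v : κ → F} {a b : κ → ℝ} {g : κ → G}
    (ha : a ~[l] fun i => ‖u i‖ ^ 2) (hb : b ~[l] fun i => ‖v i‖ ^ 2) (hab : a ≤ᶠ[l] b)
    (hv : v =O[l] g) {c : ℝ} (hc : 0 < c) : ∀ᶠ i in l, ‖u i‖ ^ 2 - ‖v i‖ ^ 2 ≤ c * ‖g i‖ ^ 2 := by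
  obtain ⟨C, hC, hO⟩ := hv.exists_pos
  filter_upwards [hO.bound, eventually_norm_sq_le_mul_norm_sq ha hb hab
    (show 1 < 1 + c / C ^ 2 by linarith [div_pos hc (pow_pos hC 2)])] with i hvi hle
  calc ‖u i‖ ^ 2 - ‖v i‖ ^ 2 ≤ c / C ^ 2 * ‖v i‖ ^ 2 := by linarith
    _ ≤ c / C ^ 2 * (C * ‖g i‖) ^ 2 := by gcongr
    _ = c * ‖g i‖ ^ 2 := by field_simp

variable [InnerProductSpace ℝ F] [NormedSpace ℝ G] {f : E → F} {V : E →L[ℝ] F} {A : G →L[ℝ] F}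
  {T : G →L[ℝ] E} {z : κ → G} {D : κ → E → ℝ} {θ : κ → E} {θ₀ : E} {K : NNReal}

lemma isBigO_argmin_sub (hf : HasFDerivAt f V θ₀) (hf0 : f θ₀ = 0) (hV : AntilipschitzWith K V)
    (hθ : Tendsto θ l (𝓝 θ₀))
    (hD : ∀ θ' : κ → E, Tendsto θ' l (𝓝 θ₀) →
      (fun i => D i (θ' i)) ~[l] fun i => ‖A (z i) - f (θ' i)‖ ^ 2)
    (hmin : ∀ᶠ i in l, D i (θ i) ≤ D i θ₀) :
    (fun i => θ i - θ₀) =O[l] z := by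
  have hVbound : ∀ h : κ → E, h =O[l] fun i => V (h i) := fun h =>
    .of_bound K (.of_forall fun i => V.bound_of_antilipschitz hV (h i))
  have hequiv : (fun i => f (θ i)) ~[l] fun i => V (θ i - θ₀) := by
    have hlin := hf.isLittleO.comp_tendsto hθ
    simp only [Function.comp_def, hf0, sub_zero] at hlin
    exact hlin.trans_isBigO (hVbound _)
  have hres : (fun i => A (z i) - f (θ i)) =O[l] z := by
    have hle := eventually_norm_sq_le_mul_norm_sq (hD θ hθ) (hD _ tendsto_const_nhds) hmin
      (show (1 : ℝ) < 2 ^ 2 by norm_num)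
    simp only [hf0, sub_zero, ← mul_pow] at hle
    refine (IsBigO.of_bound 2 ?_).trans (A.isBigO_comp z l)
    filter_upwards [hle] with i hi
    exact le_of_sq_le_sq hi (by positivity)
  have hfz : (fun i => f (θ i)) =O[l] z :=
    ((A.isBigO_comp z l).sub hres).congr_left fun i => sub_sub_cancel _ _
  exact (hVbound _).trans (hequiv.isBigO_symm.trans hfz)

lemma isLittleO_norm_sq_residual (hf : HasFDerivAt f V θ₀) (hf0 : f θ₀ = 0) {h : κ → E}
    (hh : Tendsto (fun i => θ₀ + h i) l (𝓝 θ₀)) (hO : h =O[l] z) :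
    (fun i => ‖A (z i) - f (θ₀ + h i)‖ ^ 2 - ‖A (z i) - V (h i)‖ ^ 2) =o[l]
      fun i => ‖z i‖ ^ 2 := by
  refine isLittleO_norm_sq_sub_norm_sq ?_ ((A.isBigO_comp z l).sub ((V.isBigO_comp h l).trans hO))
  have hlin := hf.isLittleO.comp_tendsto hh
  simp only [Function.comp_def, hf0, sub_zero, add_sub_cancel_left] at hlin
  exact (hlin.trans_isBigO hO).neg_left.congr_left fun i => by abel

/-- Minimizers of objective functions `D i` which behave like the squared distances
`‖A (z i) - f θ‖ ^ 2` are, to first order, the linear least squares solutions `T (z i)`: by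
Pythagoras' theorem the squared norm of `V (θ i - θ₀ - T (z i))` is a difference of two squared
distances. -/
theorem isLittleO_argmin_sub (hf : HasFDerivAt f V θ₀) (hf0 : f θ₀ = 0)
    (hV : AntilipschitzWith K V) (horth : ∀ x h, inner ℝ (A x - V (T x)) (V h) = 0)
    (hz : Tendsto z l (𝓝 0)) (hθ : Tendsto θ l (𝓝 θ₀))
    (hD : ∀ θ' : κ → E, Tendsto θ' l (𝓝 θ₀) →
      (fun i => D i (θ' i)) ~[l] fun i => ‖A (z i) - f (θ' i)‖ ^ 2)
    (hmin₀ : ∀ᶠ i in l, D i (θ i) ≤ D i θ₀)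
    (hmin : ∀ᶠ i in l, D i (θ i) ≤ D i (θ₀ + T (z i))) :
    (fun i => θ i - θ₀ - T (z i)) =o[l] z := by
  have hTz : Tendsto (fun i => θ₀ + T (z i)) l (𝓝 θ₀) := by
    simpa using tendsto_const_nhds.add ((T.continuous.tendsto 0).comp hz)
  have hO₁ : (fun i => θ i - θ₀) =O[l] z := isBigO_argmin_sub hf hf0 hV hθ hD hmin₀
  have hO₂ : (fun i => T (z i)) =O[l] z := T.isBigO_comp z l
  have hres₁ := isLittleO_norm_sq_residual (A := A) hf hf0 (by simpa using hθ) hO₁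
  have hres₂ := isLittleO_norm_sq_residual (A := A) hf hf0 hTz hO₂
  simp only [add_sub_cancel] at hres₁
  have hpyth : ∀ i, ‖V (θ i - θ₀ - T (z i))‖ ^ 2
      = ‖A (z i) - V (θ i - θ₀)‖ ^ 2 - ‖A (z i) - V (T (z i))‖ ^ 2 := fun i => by
    have hsplit : A (z i) - V (θ i - θ₀)
        = A (z i) - V (T (z i)) - V (θ i - θ₀ - T (z i)) := by
      rw [map_sub V _ (T (z i))]; abel
    rw [hsplit, norm_sub_sq_real _ (V _), horth]
    ring
  have hfz : (fun i => A (z i) - f (θ₀ + T (z i))) =O[l] z := by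
    have hO := hf.isBigO_sub.comp_tendsto hTz
    simp only [Function.comp_def, hf0, sub_zero, add_sub_cancel_left] at hO
    exact (A.isBigO_comp z l).sub (hO.trans hO₂)
  have hV_isLittleO : (fun i => ‖V (θ i - θ₀ - T (z i))‖ ^ 2) =o[l] fun i => ‖z i‖ ^ 2 := by
    refine isLittleO_iff.2 fun c hc => ?_
    have hc3 : 0 < c / 3 := by positivity
    filter_upwards [eventually_norm_sq_sub_norm_sq_le (hD θ hθ) (hD _ hTz) hmin hfz hc3,
      hres₁.def hc3, hres₂.def hc3] with i hi h₁ h₂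
    simp only [Real.norm_eq_abs, abs_sq] at h₁ h₂ ⊢
    linarith [hpyth i, (abs_le.1 h₁).1, (abs_le.1 h₂).2]
  refine (IsBigO.of_bound K (.of_forall fun i => V.bound_of_antilipschitz hV _)).trans_isLittleO ?_
  exact (hV_isLittleO.of_pow two_ne_zero).of_norm_norm

end LeastSquares

section MinimumDivergence

variable {κ ι : Type*} [Fintype ι] {β : ℝ}

lemma isEquivalent_dpd (hβ : 0 ≤ β) {l : Filter κ} {p q : κ → ι → ℝ} {r : ι → ℝ}
    (hr : ∀ j, 0 < r j) (hp : Tendsto p l (𝓝 r)) (hq : Tendsto q l (𝓝 r))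
    (hpq : ∀ᶠ i in l, ∑ j, p i j = ∑ j, q i j) :
    Asymptotics.IsEquivalent l (fun i => dpd β (p i) (q i))
      fun i => ∑ j, (β + 1) / 2 * r j ^ (β - 1) * (p i j - q i j) ^ 2 := by
  have hweight : ∀ j, 0 < (β + 1) / 2 * r j ^ (β - 1) := fun j => by
    have := hr j
    positivity
  refine Asymptotics.isLittleO_iff.2 fun ε hε => ?_
  choose δ hδ hexp using fun j => exists_dpdTerm_expansion β (hr j) (mul_pos hε (hweight j))
  have hclose : ∀ {u : κ → ι → ℝ}, Tendsto u l (𝓝 r) → ∀ᶠ i in l, ∀ j, |u i j - r j| < δ j :=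
    fun hu => eventually_all.2 fun j =>
      (tendsto_pi_nhds.1 hu j).eventually (Metric.ball_mem_nhds (r j) (hδ j))
  filter_upwards [hpq, hclose hp, hclose hq] with i hsum hpi hqi
  have hnonneg : 0 ≤ ∑ j, (β + 1) / 2 * r j ^ (β - 1) * (p i j - q i j) ^ 2 :=
    Finset.sum_nonneg fun j _ => mul_nonneg (hweight j).le (sq_nonneg _)
  rw [Pi.sub_apply, dpd_eq_sum_dpdTerm β hsum, ← Finset.sum_sub_distrib, Real.norm_eq_abs,
    Real.norm_eq_abs, abs_of_nonneg hnonneg, Finset.mul_sum]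
  refine (Finset.abs_sum_le_sum_abs _ _).trans (Finset.sum_le_sum fun j _ => ?_)
  rw [sub_sq_comm, ← mul_assoc]
  exact hexp j _ _ (hpi j) (hqi j)

lemma inner_matrixCLM_diagonal_sqrt [DecidableEq ι] {s : ι → ℝ} (hs : ∀ j, 0 ≤ s j)
    (x y : EuclideanSpace ℝ ι) :
    inner ℝ (matrixCLM (Matrix.diagonal fun j => √(s j)) x)
      (matrixCLM (Matrix.diagonal fun j => √(s j)) y) = ∑ j, s j * (x j * y j) := by
  rw [PiLp.inner_apply]
  refine Finset.sum_congr rfl fun j _ => ?_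
  simp only [matrixCLM_apply, Matrix.mulVec_diagonal, RCLike.inner_apply, conj_trivial]
  linear_combination x j * y j * Real.mul_self_sqrt (hs j)

lemma injective_matrixCLM_diagonal [DecidableEq ι] {w : ι → ℝ} (hw : ∀ j, w j ≠ 0) :
    Function.Injective (matrixCLM (Matrix.diagonal w)) := fun x y hxy => by
  ext j
  have hj := congrArg (fun z : EuclideanSpace ℝ ι => z j) hxy
  simpa only [matrixCLM_apply, Matrix.mulVec_diagonal, mul_right_inj' (hw j)] using hj

variable {E : Type*} {π : E → ι → ℝ} {Θ : Set E} {θ₀ : E}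

/-- Strong identifiability of `θ₀` within `Θ`: parameters whose images under `π` are close to
`π θ₀` are close to `θ₀`. It makes minimum divergence estimators consistent without compactness
of `Θ`. -/
def StronglyIdentified [TopologicalSpace E] (π : E → ι → ℝ) (Θ : Set E) (θ₀ : E) : Prop :=
  comap π (𝓝 (π θ₀)) ⊓ 𝓟 Θ ≤ 𝓝 θ₀

lemma StronglyIdentified.eventually_mem_of_dpd_le [TopologicalSpace E]
    (hid : StronglyIdentified π Θ θ₀) (hβ : 0 ≤ β) (hθ₀ : θ₀ ∈ Θ)
    (hpos : ∀ θ ∈ Θ, ∀ j, 0 < π θ j) (hsum : ∀ θ ∈ Θ, ∑ j, π θ j = 1) {U : Set E}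
    (hU : U ∈ 𝓝 θ₀) :
    ∀ᶠ p in 𝓝 (π θ₀), ∑ j, p j = 1 → ∀ θ ∈ Θ, dpd β p (π θ) ≤ dpd β p (π θ₀) → θ ∈ U := by
  obtain ⟨O, hO, hOU⟩ := mem_comap.1 (mem_inf_principal.1 (hid hU))
  filter_upwards [StepStress.eventually_mem_of_dpd_le hβ (hpos θ₀ hθ₀) (hsum θ₀ hθ₀) hO]
    with p hp hp1 θ hθ hle
  exact hOU (hp hp1 (π θ) (hpos θ hθ) (hsum θ hθ) hle) hθ

lemma StronglyIdentified.tendsto_of_dpd_le [TopologicalSpace E]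
    (hid : StronglyIdentified π Θ θ₀) (hβ : 0 ≤ β) (hθ₀ : θ₀ ∈ Θ)
    (hpos : ∀ θ ∈ Θ, ∀ j, 0 < π θ j) (hsum : ∀ θ ∈ Θ, ∑ j, π θ j = 1) {l : Filter κ}
    {p : κ → ι → ℝ} {θ : κ → E} (hp : Tendsto p l (𝓝 (π θ₀))) (hp1 : ∀ᶠ i in l, ∑ j, p i j = 1)
    (hθΘ : ∀ᶠ i in l, θ i ∈ Θ) (hle : ∀ᶠ i in l, dpd β (p i) (π (θ i)) ≤ dpd β (p i) (π θ₀)) :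
    Tendsto θ l (𝓝 θ₀) := by
  refine tendsto_def.2 fun U hU => ?_
  filter_upwards [hp.eventually (hid.eventually_mem_of_dpd_le hβ hθ₀ hpos hsum hU), hp1, hθΘ, hle]
    with i hi hi1 hiΘ hile
  exact hi hi1 (θ i) hiΘ hile

lemma StronglyIdentified.eventually_exists_isMinOn_dpd [TopologicalSpace E]
    [LocallyCompactSpace E] (hid : StronglyIdentified π Θ θ₀) (hβ : 0 ≤ β) (hΘ : Θ ∈ 𝓝 θ₀)
    (hpos : ∀ θ ∈ Θ, ∀ j, 0 < π θ j) (hsum : ∀ θ ∈ Θ, ∑ j, π θ j = 1) (hcont : ContinuousOn π Θ) :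
    ∀ᶠ p in 𝓝 (π θ₀), ∑ j, p j = 1 → ∃ θ ∈ Θ, IsMinOn (fun θ' => dpd β p (π θ')) Θ θ := by
  obtain ⟨C, hC, hCΘ, hCcompact⟩ := local_compact_nhds hΘ
  have hp_pos : ∀ᶠ p in 𝓝 (π θ₀), ∀ j, 0 < p j := eventually_all.2 fun j =>
    ((continuous_apply j).tendsto (π θ₀)).eventually
      (lt_mem_nhds (hpos θ₀ (mem_of_mem_nhds hΘ) j))
  filter_upwards [hp_pos, hid.eventually_mem_of_dpd_le hβ (mem_of_mem_nhds hΘ) hpos hsum hC]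
    with p hp hfar hp1
  have hdpd_cont : ContinuousOn (fun θ' => dpd β p (π θ')) C :=
    ((continuousOn_sum_dpdTerm β hp).comp (hcont.mono hCΘ) fun θ hθ => hpos θ (hCΘ hθ)).congr
      fun θ hθ => dpd_eq_sum_dpdTerm β (hp1.trans (hsum θ (hCΘ hθ)).symm)
  obtain ⟨θ₁, hθ₁, hmin⟩ := hCcompact.exists_isMinOn ⟨θ₀, mem_of_mem_nhds hC⟩ hdpd_cont
  refine ⟨θ₁, hCΘ hθ₁, fun θ hθ => ?_⟩
  by_cases hin : θ ∈ C
  · exact hmin hin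
  · refine (isMinOn_iff.1 hmin θ₀ (mem_of_mem_nhds hC)).trans ?_
    exact (not_le.1 fun hle => hin (hfar hp1 θ hθ hle)).le

variable [NormedAddCommGroup E] [NormedSpace ℝ E] {W : E →L[ℝ] EuclideanSpace ℝ ι}
  {T : EuclideanSpace ℝ ι →L[ℝ] E}

lemma StronglyIdentified.isLittleO_argmin_dpd [FiniteDimensional ℝ E]
    (hid : StronglyIdentified π Θ θ₀) (hβ : 0 ≤ β) (hΘ : Θ ∈ 𝓝 θ₀)
    (hpos : ∀ θ ∈ Θ, ∀ j, 0 < π θ j) (hsum : ∀ θ ∈ Θ, ∑ j, π θ j = 1)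
    (hW : HasFDerivAt (fun θ => WithLp.toLp 2 (π θ)) W θ₀) (hinj : Function.Injective W)
    (hT : ∀ z h, ∑ j, π θ₀ j ^ (β - 1) * ((z j - W (T z) j) * W h j) = 0)
    {l : Filter κ} {p : κ → ι → ℝ} {θ : κ → E} (hp : Tendsto p l (𝓝 (π θ₀)))
    (hp1 : ∀ᶠ i in l, ∑ j, p i j = 1) (hθΘ : ∀ᶠ i in l, θ i ∈ Θ)
    (hmin : ∀ᶠ i in l, IsMinOn (fun θ' => dpd β (p i) (π θ')) Θ (θ i)) :
    (fun i => θ i - θ₀ - T (WithLp.toLp 2 (p i - π θ₀))) =o[l]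
      fun i => WithLp.toLp 2 (p i - π θ₀) := by
  classical
  set s : ι → ℝ := fun j => (β + 1) / 2 * π θ₀ j ^ (β - 1) with hs
  have hs0 : ∀ j, 0 < s j := fun j => by
    have := hpos θ₀ (mem_of_mem_nhds hΘ) j
    positivity
  set A := matrixCLM (Matrix.diagonal fun j => √(s j))
  have hA : ∀ x y, inner ℝ (A x) (A y) = ∑ j, s j * (x j * y j) :=
    inner_matrixCLM_diagonal_sqrt fun j => (hs0 j).le
  have hAinj : Function.Injective A :=
    injective_matrixCLM_diagonal fun j => (Real.sqrt_pos.2 (hs0 j)).ne'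
  have hz : Tendsto (fun i => WithLp.toLp 2 (p i - π θ₀)) l (𝓝 0) := by
    simpa only [sub_self, WithLp.toLp_zero, Function.comp_def] using
      ((PiLp.continuous_toLp 2 _).tendsto _).comp (hp.sub_const (π θ₀))
  have hθ : Tendsto θ l (𝓝 θ₀) := hid.tendsto_of_dpd_le hβ (mem_of_mem_nhds hΘ) hpos hsum hp hp1
    hθΘ (hmin.mono fun i hi => hi (mem_of_mem_nhds hΘ))
  obtain ⟨K, -, hK⟩ := (A ∘L W).exists_antilipschitzWith
    (LinearMap.ker_eq_bot.2 (hAinj.comp hinj))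
  refine isLittleO_argmin_sub (f := fun θ => A (WithLp.toLp 2 (π θ) - WithLp.toLp 2 (π θ₀)))
    (V := A ∘L W) (A := A) (D := fun i θ' => dpd β (p i) (π θ'))
    (A.hasFDerivAt.comp θ₀ (hW.sub_const _)) (by simp) hK (fun x h => ?_) hz hθ
    (fun θ' hθ' => ?_) ?_ ?_
  · rw [ContinuousLinearMap.comp_apply, ContinuousLinearMap.comp_apply, ← map_sub, hA]
    simp only [hs, mul_assoc, ← Finset.mul_sum, PiLp.sub_apply, hT, mul_zero]
  · have hπ : Tendsto (fun i => π (θ' i)) l (𝓝 (π θ₀)) :=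
      ((PiLp.continuous_ofLp 2 _).continuousAt.tendsto.comp hW.continuousAt).comp hθ'
    have hdpd := isEquivalent_dpd hβ (hpos θ₀ (mem_of_mem_nhds hΘ)) hp hπ (by
      filter_upwards [hp1, hθ'.eventually hΘ] with i hi hiΘ
      rw [hi, hsum _ hiΘ])
    refine hdpd.congr_right (.of_forall fun i => ?_)
    simp only [← map_sub, ← WithLp.toLp_sub, sub_sub_sub_cancel_right, ← real_inner_self_eq_norm_sq,
      hA, Pi.sub_apply, ← sq, hs]
  · exact hmin.mono fun i hi => hi (mem_of_mem_nhds hΘ)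
  · have hTz : Tendsto (fun i => θ₀ + T (WithLp.toLp 2 (p i - π θ₀))) l (𝓝 θ₀) := by
      simpa using tendsto_const_nhds.add ((T.continuous.tendsto 0).comp hz)
    filter_upwards [hmin, hTz.eventually hΘ] with i hi hiΘ using hi hiΘ

/-- The minimum density power divergence functional is differentiable at the model point `π θ₀`;
its derivative is the weighted least squares solution operator `T`. -/
theorem StronglyIdentified.eventually_norm_argmin_dpd_sub_le [FiniteDimensional ℝ E]
    (hid : StronglyIdentified π Θ θ₀) (hβ : 0 ≤ β) (hΘ : Θ ∈ 𝓝 θ₀)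
    (hpos : ∀ θ ∈ Θ, ∀ j, 0 < π θ j) (hsum : ∀ θ ∈ Θ, ∑ j, π θ j = 1)
    (hW : HasFDerivAt (fun θ => WithLp.toLp 2 (π θ)) W θ₀) (hinj : Function.Injective W)
    (hT : ∀ z h, ∑ j, π θ₀ j ^ (β - 1) * ((z j - W (T z) j) * W h j) = 0) {ε : ℝ} (hε : 0 < ε) :
    ∀ᶠ p in 𝓝 (π θ₀), ∑ j, p j = 1 → ∀ θ ∈ Θ, IsMinOn (fun θ' => dpd β p (π θ')) Θ θ →
      ‖θ - θ₀ - T (WithLp.toLp 2 (p - π θ₀))‖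
        ≤ ε * ‖(WithLp.toLp 2 (p - π θ₀) : EuclideanSpace ℝ ι)‖ := by
  set M : Set ((ι → ℝ) × E) := {x | ∑ j, x.1 j = 1 ∧ x.2 ∈ Θ ∧
    IsMinOn (fun θ' => dpd β x.1 (π θ')) Θ x.2}
  have hM : ∀ᶠ x in comap Prod.fst (𝓝 (π θ₀)) ⊓ 𝓟 M, x ∈ M :=
    mem_inf_of_right (mem_principal_self M)
  have hlittle := hid.isLittleO_argmin_dpd hβ hΘ hpos hsum hW hinj hT
    (tendsto_comap.mono_left inf_le_left) (hM.mono fun _ hx => hx.1) (hM.mono fun _ hx => hx.2.1)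
    (hM.mono fun _ hx => hx.2.2)
  have hbound := hlittle.def hε
  rw [eventually_inf_principal, eventually_comap] at hbound
  filter_upwards [hbound] with p hp hp1 θ hθ hmin using hp (p, θ) rfl ⟨hp1, hθ, hmin⟩

end MinimumDivergence

/-! ### The cumulative exposure model -/

variable {L m : ℕ} {S : Design L} {θ : Param m}

lemma baseCumHazard_zero (θ : Param m) : baseCumHazard θ 0 = 0 := by
  simp [baseCumHazard]

lemma exists_gam_pos (hθ : ∀ i, 0 ≤ θ i) {s : ℝ} (h : 0 < baseCumHazard θ s) :
    ∃ i, 0 < gam θ i := by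
  by_contra! hnonpos
  have hzero : ∀ i, gam θ i = 0 := fun i => le_antisymm (hnonpos i) (hθ _)
  simp [baseCumHazard, hzero] at h

lemma baseCumHazard_nonneg (hθ : ∀ i, 0 ≤ θ i) {t : ℝ} (ht : 0 ≤ t) : 0 ≤ baseCumHazard θ t :=
  Finset.sum_nonneg fun i _ => by
    have : 0 ≤ gam θ i := hθ _
    positivity

lemma baseCumHazard_strictMonoOn (hθ : ∀ i, 0 ≤ θ i) {r : ℝ} (hr : 0 < baseCumHazard θ r) :
    StrictMonoOn (baseCumHazard θ) (Set.Ici 0) := by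
  obtain ⟨i, hi⟩ := exists_gam_pos hθ hr
  intro s hs t _ hst
  have hs : 0 ≤ s := hs
  refine Finset.sum_lt_sum (fun j _ => ?_) ⟨i, Finset.mem_univ i, ?_⟩
  · have : 0 ≤ gam θ j := hθ _
    gcongr
  · gcongr

lemma baseCumHazard_pos (hθ : ∀ i, 0 ≤ θ i) {r : ℝ} (hr : 0 < baseCumHazard θ r) {t : ℝ}
    (ht : 0 < t) : 0 < baseCumHazard θ t := by
  rw [← baseCumHazard_zero θ]
  exact baseCumHazard_strictMonoOn hθ hr Set.self_mem_Ici ht.le ht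

lemma baseCumHazard_pos_of_mem (hθ : θ ∈ paramSpace m) {t : ℝ} (ht : 0 < t) :
    0 < baseCumHazard θ t := by
  refine Finset.sum_pos (fun i _ => ?_) Finset.univ_nonempty
  have : 0 < gam θ i := hθ _
  positivity

lemma contDiff_baseCumHazard :
    ContDiff ℝ 1 fun x : Param m × ℝ => baseCumHazard x.1 x.2 := by
  unfold baseCumHazard gam
  fun_prop

lemma continuous_baseCumHazard (θ : Param m) : Continuous (baseCumHazard θ) := by
  unfold baseCumHazard
  fun_prop

variable (S) in
lemma Design.τ_pos : 0 < S.τ := by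
  rw [Design.τ, ← S.t_zero]
  exact S.t_strictMono S.k_pos

variable (S) in
lemma Design.t_nonneg (j : Fin (L + 1)) : 0 ≤ S.t j := by
  rw [← S.t_zero]
  exact S.t_strictMono.monotone (Fin.zero_le j)

variable (S) in
lemma Design.τ_lt_last : S.τ < S.t (Fin.last L) := S.t_strictMono S.k_lt

/-- `u` is the time which has to be spent at the higher stress level to accumulate the hazard
of the first stress phase; the shifting time is `u - τ`. -/
def Design.IsEquivTime (S : Design L) (θ : Param m) (u : ℝ) : Prop :=
  0 ≤ u ∧ u ≤ S.τ ∧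
    Real.exp (slope θ * S.x₂) * baseCumHazard θ u = Real.exp (slope θ * S.x₁) * baseCumHazard θ S.τ

lemma exp_mul_eq_iff {a x₁ x₂ p q : ℝ} :
    Real.exp (a * x₂) * p = Real.exp (a * x₁) * q ↔ p = Real.exp (a * (x₁ - x₂)) * q := by
  have hsplit : Real.exp (a * x₁) = Real.exp (a * x₂) * Real.exp (a * (x₁ - x₂)) := by
    rw [← Real.exp_add]; congr 1; ring
  rw [hsplit, mul_assoc]
  exact mul_right_inj' (Real.exp_pos _).ne'

variable (S) in
lemma Design.exists_isEquivTime (hθ : ∀ i, 0 ≤ θ i) : ∃ u, S.IsEquivTime θ u := by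
  have hτ := S.τ_pos
  have hnonneg : 0 ≤ baseCumHazard θ S.τ := baseCumHazard_nonneg hθ hτ.le
  have hexp : Real.exp (slope θ * (S.x₁ - S.x₂)) ≤ 1 := by
    rw [Real.exp_le_one_iff]
    exact mul_nonpos_of_nonneg_of_nonpos (hθ _) (by linarith [S.stress_lt])
  obtain ⟨u, hu, hu_eq⟩ := intermediate_value_Icc hτ.le (continuous_baseCumHazard θ).continuousOn
    (show Real.exp (slope θ * (S.x₁ - S.x₂)) * baseCumHazard θ S.τ ∈ Set.Icc _ _ from
      ⟨by rw [baseCumHazard_zero]; positivity, mul_le_of_le_one_left hnonneg hexp⟩)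
  exact ⟨u, hu.1, hu.2, exp_mul_eq_iff.2 hu_eq⟩

lemma Design.IsEquivTime.shift_eq {u : ℝ} (h : S.IsEquivTime θ u) (hθ : ∀ i, 0 ≤ θ i)
    (hpos : 0 < baseCumHazard θ S.τ) : S.shift θ = u - S.τ := by
  obtain ⟨hu0, huτ, hu⟩ := h
  rw [exp_mul_eq_iff] at hu
  refine IsGreatest.csSup_eq ⟨⟨by linarith, by rw [add_sub_cancel, hu]⟩, fun s hs => ?_⟩
  by_contra! hlt
  have hus : u < S.τ + s := by linarith
  exact ((baseCumHazard_strictMonoOn hθ hpos) hu0 (hu0.trans hus.le) hus).ne (hu.trans hs.2.symm)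

lemma Design.IsEquivTime.pos {u : ℝ} (h : S.IsEquivTime θ u) (hpos : 0 < baseCumHazard θ S.τ) :
    0 < u := by
  refine h.1.lt_of_ne ?_
  rintro rfl
  have heq := h.2.2
  rw [baseCumHazard_zero, mul_zero] at heq
  exact (mul_pos (Real.exp_pos _) hpos).ne heq

lemma Design.IsEquivTime.lt_τ {u : ℝ} (h : S.IsEquivTime θ u) (hθ : θ ∈ paramSpace m) :
    u < S.τ := by
  refine h.2.1.lt_of_ne ?_
  rintro rfl
  have hfactor : Real.exp (slope θ * (S.x₁ - S.x₂)) < 1 := by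
    rw [Real.exp_lt_one_iff]
    exact mul_neg_of_pos_of_neg (hθ _) (by linarith [S.stress_lt])
  exact (mul_lt_of_lt_one_left (baseCumHazard_pos_of_mem hθ S.τ_pos) hfactor).ne'
    (exp_mul_eq_iff.1 h.2.2)

lemma Design.IsEquivTime.cumHazard_of_le {u : ℝ} (h : S.IsEquivTime θ u) (hθ : ∀ i, 0 ≤ θ i)
    (hpos : 0 < baseCumHazard θ S.τ) {t : ℝ} (ht : t ≤ S.τ) :
    S.cumHazard θ t = Real.exp (slope θ * S.x₁) * baseCumHazard θ t := by
  rcases ht.lt_or_eq with ht | rfl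
  · rw [Design.cumHazard, if_pos ht]
  · rw [Design.cumHazard, if_neg (lt_irrefl _), h.shift_eq hθ hpos, add_sub_cancel, h.2.2]

lemma Design.IsEquivTime.cumHazard_of_ge {u : ℝ} (h : S.IsEquivTime θ u) (hθ : ∀ i, 0 ≤ θ i)
    (hpos : 0 < baseCumHazard θ S.τ) {t : ℝ} (ht : S.τ ≤ t) :
    S.cumHazard θ t = Real.exp (slope θ * S.x₂) * baseCumHazard θ (t - S.τ + u) := by
  rw [Design.cumHazard, if_neg (not_lt.2 ht), h.shift_eq hθ hpos]
  congr 2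
  ring

lemma Design.baseCumHazard_τ_pos_of_cumHazard (hθ : ∀ i, 0 ≤ θ i) (h : 0 < S.cumHazard θ S.τ) :
    0 < baseCumHazard θ S.τ := by
  rw [Design.cumHazard, if_neg (lt_irrefl _)] at h
  exact baseCumHazard_pos hθ (pos_of_mul_pos_right h (Real.exp_pos _).le) S.τ_pos

variable (S) in
lemma Design.cumHazard_zero (θ : Param m) : S.cumHazard θ 0 = 0 := by
  rw [Design.cumHazard, if_pos S.τ_pos, baseCumHazard_zero, mul_zero]

variable (S) in
lemma Design.cumHazard_strictMonoOn (hθ : θ ∈ paramSpace m) :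
    StrictMonoOn (S.cumHazard θ) (Set.Ici 0) := by
  have hθ0 : ∀ i, 0 ≤ θ i := fun i => (hθ i).le
  have hpos := baseCumHazard_pos_of_mem hθ S.τ_pos
  have hmono := baseCumHazard_strictMonoOn hθ0 hpos
  obtain ⟨u, hu⟩ := S.exists_isEquivTime hθ0
  have hphase₁ : StrictMonoOn (S.cumHazard θ) (Set.Icc 0 S.τ) := fun s hs t ht hst => by
    rw [hu.cumHazard_of_le hθ0 hpos ht.2, hu.cumHazard_of_le hθ0 hpos hs.2]
    exact mul_lt_mul_of_pos_left (hmono hs.1 ht.1 hst) (Real.exp_pos _)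
  have hphase₂ : StrictMonoOn (S.cumHazard θ) (Set.Ici S.τ) := fun s hs t ht hst => by
    rw [hu.cumHazard_of_ge hθ0 hpos ht, hu.cumHazard_of_ge hθ0 hpos hs]
    have hnonneg : ∀ r ∈ Set.Ici S.τ, r - S.τ + u ∈ Set.Ici 0 := fun r hr =>
      add_nonneg (sub_nonneg.2 hr) hu.1
    exact mul_lt_mul_of_pos_left (hmono (hnonneg s hs) (hnonneg t ht) (by linarith))
      (Real.exp_pos _)
  rw [← Set.Icc_union_Ici_eq_Ici S.τ_pos.le]
  exact hphase₁.union hphase₂ (isGreatest_Icc S.τ_pos.le) isLeast_Ici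

section CellProb

variable (S)

lemma Design.cellProb_castSucc (θ : Param m) (j : Fin L) : S.cellProb θ j.castSucc
    = S.reliability θ (S.t j.castSucc) - S.reliability θ (S.t j.succ) := by
  simp [Design.cellProb]

lemma Design.cellProb_last (θ : Param m) :
    S.cellProb θ (Fin.last L) = S.reliability θ (S.t (Fin.last L)) := by
  simp [Design.cellProb]

lemma Design.reliability_t_zero (θ : Param m) : S.reliability θ (S.t 0) = 1 := by
  rw [Design.reliability, S.t_zero, S.cumHazard_zero, neg_zero, Real.exp_zero]

lemma Design.reliability_t (θ : Param m) (j : Fin (L + 1)) :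
    S.reliability θ (S.t j) = 1 - ∑ i ∈ Finset.Iio j, S.cellProb θ i := by
  induction j using Fin.induction with
  | zero =>
    have hempty : Finset.Iio (0 : Fin (L + 1)) = ∅ := by
      ext i; simp
    rw [hempty, S.reliability_t_zero, Finset.sum_empty, sub_zero]
  | succ j ih =>
    have hinsert : Finset.Iio j.succ = insert j.castSucc (Finset.Iio j.castSucc) := by
      ext i
      simp only [Finset.mem_Iio, Finset.mem_insert, Fin.lt_def, Fin.ext_iff, Fin.val_succ,
        Fin.val_castSucc]
      omega
    rw [hinsert, Finset.sum_insert (by simp), S.cellProb_castSucc, ih]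
    ring

lemma Design.cumHazard_t (θ : Param m) (j : Fin (L + 1)) :
    S.cumHazard θ (S.t j) = -Real.log (1 - ∑ i ∈ Finset.Iio j, S.cellProb θ i) := by
  rw [← S.reliability_t, Design.reliability, Real.log_exp, neg_neg]

lemma Design.sum_cellProb (θ : Param m) : ∑ j, S.cellProb θ j = 1 := by
  have huniv : (Finset.univ : Finset (Fin (L + 1)))
      = insert (Fin.last L) (Finset.Iio (Fin.last L)) := by
    ext i
    simp only [Finset.mem_univ, Finset.mem_insert, Finset.mem_Iio, Fin.lt_last_iff_ne_last,
      true_iff]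
    exact em _
  rw [huniv, Finset.sum_insert (by simp), S.cellProb_last, S.reliability_t]
  ring

lemma Design.cellProb_pos (hθ : θ ∈ paramSpace m) (j : Fin (L + 1)) : 0 < S.cellProb θ j := by
  induction j using Fin.lastCases with
  | last => exact S.cellProb_last θ ▸ Real.exp_pos _
  | cast j =>
    rw [S.cellProb_castSucc, sub_pos]
    exact Real.exp_lt_exp.2 (neg_lt_neg (S.cumHazard_strictMonoOn hθ (S.t_nonneg _)
      (S.t_nonneg _) (S.t_strictMono Fin.castSucc_lt_succ)))

end CellProb

/-! ### Differentiability of the cell probabilities -/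

lemma isOpen_paramSpace : IsOpen (paramSpace m) := by
  simp only [paramSpace, Set.ofPred_forall]
  exact isOpen_iInter_of_finite fun i => isOpen_lt continuous_const (by fun_prop)

/-- The baseline hazard. -/
def baseHazard (θ : Param m) (t : ℝ) : ℝ := ∑ i : Fin (m + 1), gam θ i * t ^ (i : ℕ)

lemma hasDerivAt_baseCumHazard (θ : Param m) (t : ℝ) :
    HasDerivAt (baseCumHazard θ) (baseHazard θ t) t := by
  refine HasDerivAt.fun_sum fun i _ => ?_
  have hterm := ((hasDerivAt_pow ((i : ℕ) + 1) t).const_mul (gam θ i)).div_const ((i : ℝ) + 1)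
  have hval : gam θ i * t ^ (i : ℕ)
      = gam θ i * (((i : ℕ) + 1 : ℕ) * t ^ ((i : ℕ) + 1 - 1)) / ((i : ℝ) + 1) := by
    push_cast
    field_simp
  exact hval ▸ hterm

lemma baseHazard_pos (hθ : θ ∈ paramSpace m) {t : ℝ} (ht : 0 ≤ t) : 0 < baseHazard θ t := by
  refine Finset.sum_pos' (fun i _ => mul_nonneg (hθ _).le (pow_nonneg ht _))
    ⟨0, Finset.mem_univ 0, ?_⟩
  simp only [Fin.val_zero, pow_zero, mul_one]
  exact hθ _

lemma exists_differentiableAt_implicit {E : Type*} [NormedAddCommGroup E] [NormedSpace ℝ E]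
    [CompleteSpace E] {f : E × ℝ → ℝ} {a : E} {u d : ℝ} (hf : ContDiffAt ℝ 1 f (a, u))
    (hd : HasDerivAt (fun s => f (a, s)) d u) (hd0 : d ≠ 0) :
    ∃ ψ : E → ℝ, DifferentiableAt ℝ ψ a ∧ Tendsto ψ (𝓝 a) (𝓝 u) ∧
      ∀ᶠ x in 𝓝 a, f (x, ψ x) = f (a, u) := by
  have hstrict := hf.hasStrictFDerivAt one_ne_zero
  have hpartial : fderiv ℝ f (a, u) (0, 1) = d :=
    (hstrict.hasFDerivAt.comp_hasDerivAt u
      ((hasDerivAt_const u a).prodMk (hasDerivAt_id u))).unique hd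
  have hinv : (fderiv ℝ f (a, u) ∘L .inr ℝ E ℝ).IsInvertible := by
    refine ContinuousLinearMap.IsInvertible.of_inverse
      (g := d⁻¹ • ContinuousLinearMap.id ℝ ℝ) ?_ ?_ <;>
    · ext
      simp [hpartial, hd0]
  exact ⟨hstrict.implicitFunctionOfProdDomain hinv,
    (hstrict.hasStrictFDerivAt_implicitFunctionOfProdDomain hinv).hasFDerivAt.differentiableAt,
    hstrict.tendsto_implicitFunctionOfProdDomain hinv,
    hstrict.eventually_apply_implicitFunctionOfProdDomain hinv⟩

section Differentiability

variable (S)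

lemma differentiable_slope : Differentiable ℝ fun θ : Param m => slope θ := by
  unfold slope
  fun_prop

lemma Design.differentiableAt_shift (hθ : θ ∈ paramSpace m) :
    DifferentiableAt ℝ (fun θ : Param m => S.shift θ) θ := by
  obtain ⟨u, hu⟩ := S.exists_isEquivTime fun i => (hθ i).le
  have hu0 := hu.pos (baseCumHazard_pos_of_mem hθ S.τ_pos)
  set f : Param m × ℝ → ℝ := fun x => baseCumHazard x.1 x.2
    - Real.exp (slope x.1 * (S.x₁ - S.x₂)) * baseCumHazard x.1 S.τ
  have hf : ContDiff ℝ 1 f := by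
    refine contDiff_baseCumHazard.sub (ContDiff.mul ?_ ?_)
    · unfold slope
      fun_prop
    · exact contDiff_baseCumHazard.comp (contDiff_fst.prodMk contDiff_const)
  obtain ⟨ψ, hψ_diff, hψ_lim, hψ⟩ := exists_differentiableAt_implicit (f := f) (a := θ)
    hf.contDiffAt ((hasDerivAt_baseCumHazard θ u).sub_const
      (Real.exp (slope θ * (S.x₁ - S.x₂)) * baseCumHazard θ S.τ)) (baseHazard_pos hθ hu0.le).ne'
  have hzero : f (θ, u) = 0 := sub_eq_zero.2 (exp_mul_eq_iff.1 hu.2.2)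
  have hshift : (fun θ : Param m => S.shift θ) =ᶠ[𝓝 θ] fun θ => ψ θ - S.τ := by
    filter_upwards [hψ, hψ_lim.eventually (Ioo_mem_nhds hu0 (hu.lt_τ hθ)),
      isOpen_paramSpace.mem_nhds hθ] with θ' heq hIoo hθ'
    have hequiv : S.IsEquivTime θ' (ψ θ') :=
      ⟨hIoo.1.le, hIoo.2.le, exp_mul_eq_iff.2 (sub_eq_zero.1 (heq.trans hzero))⟩
    exact hequiv.shift_eq (fun i => (hθ' i).le) (baseCumHazard_pos_of_mem hθ' S.τ_pos)
  exact (hψ_diff.sub_const _).congr_of_eventuallyEq hshift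

lemma Design.differentiableAt_cumHazard (hθ : θ ∈ paramSpace m) (t : ℝ) :
    DifferentiableAt ℝ (fun θ : Param m => S.cumHazard θ t) θ := by
  have hexp : ∀ x : ℝ, DifferentiableAt ℝ (fun θ : Param m => Real.exp (slope θ * x)) θ :=
    fun x => ((differentiable_slope θ).mul_const x).exp
  have hbase : ∀ g : Param m → ℝ, DifferentiableAt ℝ g θ →
      DifferentiableAt ℝ (fun θ : Param m => baseCumHazard θ (g θ)) θ := fun g hg =>
    DifferentiableAt.comp (g := fun x : Param m × ℝ => baseCumHazard x.1 x.2) θ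
      (contDiff_baseCumHazard.differentiable one_ne_zero _) (differentiableAt_id.prodMk hg)
  unfold Design.cumHazard
  split_ifs
  · exact (hexp _).mul (hbase _ (differentiableAt_const t))
  · exact (hexp _).mul (hbase _ ((S.differentiableAt_shift hθ).const_add t))

lemma Design.differentiableAt_cellProb (hθ : θ ∈ paramSpace m) :
    DifferentiableAt ℝ (fun θ : Param m => S.cellProb θ) θ := by
  have hrel : ∀ t, DifferentiableAt ℝ (fun θ : Param m => S.reliability θ t) θ := fun t =>
    (S.differentiableAt_cumHazard hθ t).neg.exp
  refine differentiableAt_pi.2 fun j => ?_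
  induction j using Fin.lastCases with
  | last => simpa only [S.cellProb_last] using hrel _
  | cast j =>
    simp only [S.cellProb_castSucc]
    exact (hrel _).sub (hrel _)

end Differentiability

/-! ### Identified parameters are strongly identified -/

/-- The cumulative hazard at `t` of a unit for which the first stress phase is equivalent to an
exposure of length `u` to the higher stress. In contrast to `Design.cumHazard` it is jointly
continuous in `θ` and `u` on the whole space. -/
def Design.cumHazardOf (S : Design L) (θ : Param m) (u t : ℝ) : ℝ :=
  if t ≤ S.τ then Real.exp (slope θ * S.x₁) * baseCumHazard θ t
  else Real.exp (slope θ * S.x₂) * baseCumHazard θ (t - S.τ + u)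

lemma Design.IsEquivTime.cumHazardOf_eq {u : ℝ} (h : S.IsEquivTime θ u) (hθ : ∀ i, 0 ≤ θ i)
    (hpos : 0 < baseCumHazard θ S.τ) (t : ℝ) : S.cumHazardOf θ u t = S.cumHazard θ t := by
  rw [Design.cumHazardOf]
  split_ifs with ht
  · exact (h.cumHazard_of_le hθ hpos ht).symm
  · exact (h.cumHazard_of_ge hθ hpos (le_of_not_ge ht)).symm

lemma continuous_exp_mul_baseCumHazard {X : Type*} [TopologicalSpace X] (x : ℝ)
    {f : X → Param m} {g : X → ℝ} (hf : Continuous f) (hg : Continuous g) :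
    Continuous fun y => Real.exp (slope (f y) * x) * baseCumHazard (f y) (g y) :=
  ((differentiable_slope.continuous.comp hf).mul_const x).rexp.mul
    (contDiff_baseCumHazard.continuous.comp (hf.prodMk hg))

variable (S) in
lemma Design.continuous_cumHazardOf (t : ℝ) :
    Continuous fun y : Param m × ℝ => S.cumHazardOf y.1 y.2 t := by
  unfold Design.cumHazardOf
  split_ifs
  · exact continuous_exp_mul_baseCumHazard S.x₁ continuous_fst continuous_const
  · exact continuous_exp_mul_baseCumHazard S.x₂ continuous_fst
      (continuous_const.add continuous_snd)

variable (S) in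
lemma Design.isClosed_setOf_isEquivTime :
    IsClosed {y : Param m × ℝ | S.IsEquivTime y.1 y.2} :=
  (isClosed_le continuous_const continuous_snd).inter
    ((isClosed_le continuous_snd continuous_const).inter
      (isClosed_eq (continuous_exp_mul_baseCumHazard S.x₂ continuous_fst continuous_snd)
        (continuous_exp_mul_baseCumHazard S.x₁ continuous_fst continuous_const)))

lemma pow_mul_baseCumHazard_le (hθ : ∀ i, 0 ≤ θ i) {c t : ℝ} (hc : 0 ≤ c) (hc1 : c ≤ 1)
    (ht : 0 ≤ t) : c ^ (m + 1) * baseCumHazard θ t ≤ baseCumHazard θ (c * t) := by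
  unfold baseCumHazard
  rw [Finset.mul_sum]
  refine Finset.sum_le_sum fun i _ => ?_
  have hγ : 0 ≤ gam θ i := hθ _
  calc c ^ (m + 1) * (gam θ i * t ^ ((i : ℕ) + 1) / ((i : ℕ) + 1))
      ≤ c ^ ((i : ℕ) + 1) * (gam θ i * t ^ ((i : ℕ) + 1) / ((i : ℕ) + 1)) :=
        mul_le_mul_of_nonneg_right (pow_le_pow_of_le_one hc hc1 (by omega)) (by positivity)
    _ = gam θ i * (c * t) ^ ((i : ℕ) + 1) / ((i : ℕ) + 1) := by ring

lemma gam_mul_pow_div_le (hθ : ∀ i, 0 ≤ θ i) {t : ℝ} (ht : 0 ≤ t) (i : Fin (m + 1)) :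
    gam θ i * t ^ ((i : ℕ) + 1) / ((i : ℕ) + 1) ≤ baseCumHazard θ t :=
  Finset.single_le_sum (f := fun i : Fin (m + 1) => gam θ i * t ^ ((i : ℕ) + 1) / ((i : ℕ) + 1))
    (fun j _ => by have : 0 ≤ gam θ j := hθ _; positivity) (Finset.mem_univ i)

lemma Design.IsEquivTime.exp_mul_cumHazard_le {u : ℝ} (h : S.IsEquivTime θ u)
    (hθ : ∀ i, 0 ≤ θ i) (hpos : 0 < baseCumHazard θ S.τ) {c t : ℝ} (hc : 0 ≤ c) (hc1 : c ≤ 1)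
    (ht : c * S.τ ≤ t - S.τ) :
    Real.exp (slope θ * (S.x₂ - S.x₁)) * (c ^ (m + 1) * S.cumHazard θ S.τ)
      ≤ S.cumHazard θ t := by
  have hcτ : 0 ≤ c * S.τ := mul_nonneg hc S.τ_pos.le
  have hexp : Real.exp (slope θ * S.x₂)
      = Real.exp (slope θ * (S.x₂ - S.x₁)) * Real.exp (slope θ * S.x₁) := by
    rw [← Real.exp_add]; congr 1; ring
  rw [h.cumHazard_of_le hθ hpos le_rfl, h.cumHazard_of_ge hθ hpos (by linarith)]
  calc _ = Real.exp (slope θ * S.x₂) * (c ^ (m + 1) * baseCumHazard θ S.τ) := by rw [hexp]; ring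
    _ ≤ Real.exp (slope θ * S.x₂) * baseCumHazard θ (t - S.τ + u) := by
      gcongr
      exact (pow_mul_baseCumHazard_le hθ hc hc1 S.τ_pos.le).trans
        ((baseCumHazard_strictMonoOn hθ hpos).monotoneOn hcτ
          (hcτ.trans (by linarith [h.1])) (by linarith [h.1]))

variable (S m) in
lemma Design.exists_slope_le {A M : ℝ} (hA : 0 < A) (hM : 0 < M) :
    ∃ R, ∀ θ ∈ paramSpace m, A ≤ S.cumHazard θ S.τ → S.cumHazard θ (S.t (Fin.last L)) ≤ M →
      slope θ ≤ R := by
  have hd : 0 < S.t (Fin.last L) - S.τ := sub_pos.2 S.τ_lt_last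
  set c := min 1 ((S.t (Fin.last L) - S.τ) / S.τ)
  have hc : 0 < c := lt_min one_pos (div_pos hd S.τ_pos)
  refine ⟨Real.log (M / (c ^ (m + 1) * A)) / (S.x₂ - S.x₁), fun θ hθ hAθ hθM => ?_⟩
  have hθ0 : ∀ i, 0 ≤ θ i := fun i => (hθ i).le
  obtain ⟨u, hu⟩ := S.exists_isEquivTime hθ0
  rw [le_div_iff₀ (sub_pos.2 S.stress_lt), Real.le_log_iff_exp_le (by positivity),
    le_div_iff₀ (by positivity)]
  calc Real.exp (slope θ * (S.x₂ - S.x₁)) * (c ^ (m + 1) * A)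
      ≤ Real.exp (slope θ * (S.x₂ - S.x₁)) * (c ^ (m + 1) * S.cumHazard θ S.τ) := by gcongr
    _ ≤ S.cumHazard θ (S.t (Fin.last L)) :=
      hu.exp_mul_cumHazard_le hθ0 (baseCumHazard_pos_of_mem hθ S.τ_pos) hc.le (min_le_left _ _)
        ((le_div_iff₀ S.τ_pos).1 (min_le_right _ _))
    _ ≤ M := hθM

variable (S m) in
lemma Design.exists_gam_le (a M : ℝ) (i : Fin (m + 1)) :
    ∃ R, ∀ θ ∈ paramSpace m, slope θ ≤ a → S.cumHazard θ S.τ ≤ M → gam θ i ≤ R := by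
  have hτ := S.τ_pos
  refine ⟨Real.exp (a * |S.x₁|) * M / (S.τ ^ ((i : ℕ) + 1) / ((i : ℕ) + 1)),
    fun θ hθ hslope hθM => ?_⟩
  have hθ0 : ∀ i, 0 ≤ θ i := fun i => (hθ i).le
  obtain ⟨u, hu⟩ := S.exists_isEquivTime hθ0
  rw [hu.cumHazard_of_le hθ0 (baseCumHazard_pos_of_mem hθ hτ) le_rfl] at hθM
  have hexponent : -(slope θ * S.x₁) ≤ a * |S.x₁| :=
    calc -(slope θ * S.x₁) = slope θ * -S.x₁ := by ring
      _ ≤ slope θ * |S.x₁| := mul_le_mul_of_nonneg_left (neg_le_abs _) (hθ0 _)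
      _ ≤ a * |S.x₁| := by gcongr
  rw [le_div_iff₀ (by positivity), ← mul_div_assoc]
  calc gam θ i * S.τ ^ ((i : ℕ) + 1) / ((i : ℕ) + 1) ≤ baseCumHazard θ S.τ :=
        gam_mul_pow_div_le hθ0 hτ.le i
    _ = Real.exp (-(slope θ * S.x₁)) * (Real.exp (slope θ * S.x₁) * baseCumHazard θ S.τ) := by
      rw [← mul_assoc, ← Real.exp_add, neg_add_cancel, Real.exp_zero, one_mul]
    _ ≤ Real.exp (a * |S.x₁|) * M :=
      mul_le_mul (Real.exp_le_exp.2 hexponent) hθM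
        (mul_nonneg (Real.exp_pos _).le (baseCumHazard_nonneg hθ0 hτ.le)) (Real.exp_pos _).le

variable (S m) in
lemma Design.exists_apply_le {A M : ℝ} (hA : 0 < A) (hM : 0 < M) (i : Fin (m + 2)) :
    ∃ R, ∀ θ ∈ paramSpace m, A ≤ S.cumHazard θ S.τ → S.cumHazard θ S.τ ≤ M →
      S.cumHazard θ (S.t (Fin.last L)) ≤ M → θ i ≤ R := by
  obtain ⟨a, ha⟩ := S.exists_slope_le m hA hM
  induction i using Fin.lastCases with
  | last => exact ⟨a, fun θ hθ hAθ _ hLM => ha θ hθ hAθ hLM⟩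
  | cast i =>
    obtain ⟨R, hR⟩ := S.exists_gam_le m a M i
    exact ⟨R, fun θ hθ hAθ hτM hLM => hR θ hθ (ha θ hθ hAθ hLM) hτM⟩

lemma isCompact_setOf_forall_mem_Icc {ι : Type*} [Finite ι] (a b : ι → ℝ) :
    IsCompact {θ : EuclideanSpace ℝ ι | ∀ i, θ i ∈ Set.Icc (a i) (b i)} := by
  have := Fintype.ofFinite ι
  convert (EuclideanSpace.equiv ι ℝ).toHomeomorph.isCompact_preimage.2
    (isCompact_univ_pi fun i => isCompact_Icc (a := a i) (b := b i)) using 1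
  ext θ
  simp only [Set.mem_ofPred_eq, Set.mem_preimage, Set.mem_pi, Set.mem_univ, true_imp_iff]
  rfl

section StronglyIdentified

variable {θ₀ : Param m} {F : Filter (Param m)}

lemma Design.cumHazard_τ_pos (hθ : θ ∈ paramSpace m) : 0 < S.cumHazard θ S.τ :=
  (S.cumHazard_zero θ).symm.trans_lt
    (S.cumHazard_strictMonoOn hθ Set.self_mem_Ici S.τ_pos.le S.τ_pos)

lemma Design.tendsto_cumHazard_of_tendsto_cellProb
    (h : Tendsto S.cellProb F (𝓝 (S.cellProb θ₀))) (j : Fin (L + 1)) :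
    Tendsto (fun θ => S.cumHazard θ (S.t j)) F (𝓝 (S.cumHazard θ₀ (S.t j))) := by
  simp only [S.cumHazard_t]
  refine (Tendsto.log ((tendsto_finsetSum _ fun i _ => (tendsto_pi_nhds.1 h) i).const_sub 1)
    ?_).neg
  rw [← S.reliability_t]
  exact (Real.exp_pos _).ne'

lemma Design.eventually_forall_mem_Icc (hθ₀ : θ₀ ∈ paramSpace m)
    (h : Tendsto S.cellProb F (𝓝 (S.cellProb θ₀))) (hF : ∀ᶠ θ in F, θ ∈ paramSpace m) :
    ∃ R : Fin (m + 2) → ℝ, ∀ᶠ θ in F, ∀ i, θ i ∈ Set.Icc 0 (R i) := by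
  have hpos := S.cumHazard_τ_pos hθ₀
  have hmono := S.cumHazard_strictMonoOn hθ₀ S.τ_pos.le (S.t_nonneg (Fin.last L)) S.τ_lt_last
  have hlim_τ : Tendsto (fun θ => S.cumHazard θ S.τ) F (𝓝 (S.cumHazard θ₀ S.τ)) :=
    S.tendsto_cumHazard_of_tendsto_cellProb h S.k
  have hlim_last := S.tendsto_cumHazard_of_tendsto_cellProb h (Fin.last L)
  choose R hR using S.exists_apply_le m (half_pos hpos) ((hpos.trans hmono).trans (lt_add_one _))
  refine ⟨R, ?_⟩
  filter_upwards [hF, hlim_τ.eventually_const_le (half_lt_self hpos),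
    hlim_τ.eventually_le_const (hmono.trans (lt_add_one _)),
    hlim_last.eventually_le_const (lt_add_one _)] with θ hθ hA hτM hLM i
  exact ⟨(hθ i).le, hR i θ hθ hA hτM hLM⟩

lemma Design.cellProb_eq_of_cumHazard_eq {θ' : Param m}
    (h : ∀ j, S.cumHazard θ (S.t j) = S.cumHazard θ' (S.t j)) : S.cellProb θ = S.cellProb θ' := by
  funext j
  induction j using Fin.lastCases with
  | last => simp only [S.cellProb_last, Design.reliability, h]
  | cast j => simp only [S.cellProb_castSucc, Design.reliability, h]

/-- The limit may lie on the boundary of the parameter space. -/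
lemma Design.cellProb_eq_of_tendsto [F.NeBot] (hθ₀ : θ₀ ∈ paramSpace m)
    (h : Tendsto S.cellProb F (𝓝 (S.cellProb θ₀))) (hF : ∀ᶠ θ in F, θ ∈ paramSpace m)
    (hθ : ∀ i, 0 ≤ θ i) {u : Param m → ℝ} {v : ℝ} (hu : ∀ᶠ θ in F, S.IsEquivTime θ (u θ))
    (hlim : Tendsto (fun θ => (θ, u θ)) F (𝓝 (θ, v))) : S.cellProb θ = S.cellProb θ₀ := by
  have hequiv : S.IsEquivTime θ v := S.isClosed_setOf_isEquivTime.mem_of_tendsto hlim hu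
  have hcumHazardOf : ∀ j, S.cumHazardOf θ v (S.t j) = S.cumHazard θ₀ (S.t j) := fun j => by
    refine tendsto_nhds_unique (((S.continuous_cumHazardOf (S.t j)).tendsto _).comp hlim)
      ((S.tendsto_cumHazard_of_tendsto_cellProb h j).congr' ?_)
    filter_upwards [hF, hu] with θ' hθ' hu'
    exact (hu'.cumHazardOf_eq (fun i => (hθ' i).le)
      (baseCumHazard_pos_of_mem hθ' S.τ_pos) _).symm
  have hpos : 0 < baseCumHazard θ S.τ := by
    have hτ := S.cumHazard_τ_pos hθ₀
    rw [Design.τ, ← hcumHazardOf S.k, Design.cumHazardOf,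
      if_pos (show S.t S.k ≤ S.τ from le_rfl)] at hτ
    exact pos_of_mul_pos_right hτ (Real.exp_pos _).le
  refine S.cellProb_eq_of_cumHazard_eq fun j => ?_
  rw [← hequiv.cumHazardOf_eq hθ hpos, hcumHazardOf]

theorem Design.IdentifiableAt.stronglyIdentified (h : S.IdentifiableAt θ₀)
    (hθ₀ : θ₀ ∈ paramSpace m) : StronglyIdentified S.cellProb (paramSpace m) θ₀ := by
  refine le_iff_ultrafilter.2 fun G hG => ?_
  obtain ⟨hπ, hmem⟩ := le_inf_iff.1 hG
  rw [← tendsto_iff_comap] at hπ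
  rw [le_principal_iff] at hmem
  obtain ⟨R, hR⟩ := S.eventually_forall_mem_Icc hθ₀ hπ hmem
  have hequiv : ∀ θ ∈ paramSpace m, S.IsEquivTime θ (S.τ + S.shift θ) := fun θ hθ => by
    obtain ⟨u, hu⟩ := S.exists_isEquivTime fun i => (hθ i).le
    rwa [hu.shift_eq (fun i => (hθ i).le) (baseCumHazard_pos_of_mem hθ S.τ_pos), add_sub_cancel]
  have hbox : ∀ᶠ θ in G, (θ, S.τ + S.shift θ) ∈
      {θ : Param m | ∀ i, θ i ∈ Set.Icc 0 (R i)} ×ˢ Set.Icc 0 S.τ := by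
    filter_upwards [hR, hmem] with θ hθR hθ
    exact ⟨hθR, (hequiv θ hθ).1, (hequiv θ hθ).2.1⟩
  obtain ⟨⟨θ, v⟩, hθv, hlim⟩ :=
    ((isCompact_setOf_forall_mem_Icc 0 R).prod isCompact_Icc).ultrafilter_le_nhds
      (G.map fun θ => (θ, S.τ + S.shift θ)) (le_principal_iff.2 hbox)
  have hθ : ∀ i, 0 ≤ θ i := fun i => (hθv.1 i).1
  have hlimθ : (G : Filter (Param m)) ≤ 𝓝 θ := (continuous_fst.tendsto (θ, v)).comp hlim
  rwa [h θ hθ (S.cellProb_eq_of_tendsto hθ₀ hπ hmem hθ (mem_of_superset hmem hequiv) hlim)]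
    at hlimθ

end StronglyIdentified

/-! ### Interpolation at the inspection times -/

section Interpolation

open Polynomial

/-- The cumulative baseline hazard as a polynomial in time, to which interpolation at the
inspection times applies. -/
def hazardPoly (θ : Param m) : ℝ[X] :=
  ∑ i : Fin (m + 1), C (gam θ i / ((i : ℕ) + 1)) * X ^ ((i : ℕ) + 1)

lemma eval_hazardPoly (θ : Param m) (t : ℝ) : (hazardPoly θ).eval t = baseCumHazard θ t := by
  simp only [hazardPoly, baseCumHazard, eval_finsetSum, eval_mul, eval_C, eval_pow, eval_X]
  exact Finset.sum_congr rfl fun i _ => by ring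

lemma eval_derivative_hazardPoly (θ : Param m) (t : ℝ) :
    (derivative (hazardPoly θ)).eval t = baseHazard θ t := by
  refine ((hazardPoly θ).hasDerivAt t).unique ?_
  rw [funext (eval_hazardPoly θ)]
  exact hasDerivAt_baseCumHazard θ t

lemma coeff_hazardPoly_succ (θ : Param m) (i : Fin (m + 1)) :
    (hazardPoly θ).coeff ((i : ℕ) + 1) = gam θ i / ((i : ℕ) + 1) := by
  simp [hazardPoly, Fin.val_inj]

lemma hazardPoly_mem_degreeLE (θ : Param m) : hazardPoly θ ∈ degreeLE ℝ (m + 1 : ℕ) :=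
  Submodule.sum_mem _ fun i _ => mem_degreeLE.2 <|
    (degree_C_mul_X_pow_le _ _).trans (by exact_mod_cast i.is_lt)

lemma derivative_hazardPoly_mem_degreeLE (θ : Param m) :
    derivative (hazardPoly θ) ∈ degreeLE ℝ (m + 1 : ℕ) :=
  mem_degreeLE.2 (degree_derivative_le.trans (mem_degreeLE.1 (hazardPoly_mem_degreeLE θ)))

lemma gam_eq_of_baseCumHazard_eq {θ' : Param m}
    (h : ∀ t, baseCumHazard θ t = baseCumHazard θ' t) (i : Fin (m + 1)) : gam θ i = gam θ' i := by
  have hpoly : hazardPoly θ = hazardPoly θ' :=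
    Polynomial.funext fun t => by rw [eval_hazardPoly, eval_hazardPoly, h]
  have hcoeff := congrArg (coeff · ((i : ℕ) + 1)) hpoly
  simp only [coeff_hazardPoly_succ] at hcoeff
  exact (div_left_inj' (by positivity)).1 hcoeff

lemma param_ext {θ' : Param m} (hslope : slope θ = slope θ')
    (h : ∀ t, baseCumHazard θ t = baseCumHazard θ' t) : θ = θ' := by
  ext i
  induction i using Fin.lastCases with
  | last => exact hslope
  | cast i => exact gam_eq_of_baseCumHazard_eq h i

variable {J : Finset (Fin (L + 1))}

lemma Design.eval_eq_of_eval_t_eq {d : ℕ} (hJ : d < J.card) {p q : ℝ[X]}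
    (hp : p ∈ degreeLE ℝ d) (hq : q ∈ degreeLE ℝ d) {w w' : ℝ}
    (h : ∀ j ∈ J, p.eval (S.t j + w) = q.eval (S.t j + w')) (t : ℝ) :
    p.eval (t + w) = q.eval (t + w') := by
  have hJ : (d : WithBot ℕ) < J.card := by exact_mod_cast hJ
  rw [← taylor_eval, ← taylor_eval]
  congr 1
  refine eq_of_degrees_lt_of_eval_index_eq J (v := S.t) S.t_strictMono.injective.injOn ?_ ?_
    fun j hj => ?_
  · exact (degree_taylor _ _).trans_lt ((mem_degreeLE.1 hp).trans_lt hJ)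
  · exact (degree_taylor _ _).trans_lt ((mem_degreeLE.1 hq).trans_lt hJ)
  · rw [taylor_eval, taylor_eval, h j hj]

lemma Design.mul_baseCumHazard_eq_of_forall_mem (hJ : m + 1 < J.card) {θ' : Param m}
    {c c' w w' : ℝ}
    (h : ∀ j ∈ J, c * baseCumHazard θ (S.t j + w) = c' * baseCumHazard θ' (S.t j + w')) (t : ℝ) :
    c * baseCumHazard θ (t + w) = c' * baseCumHazard θ' (t + w') := by
  simpa only [eval_smul, eval_hazardPoly, smul_eq_mul] using
    S.eval_eq_of_eval_t_eq hJ (Submodule.smul_mem _ c (hazardPoly_mem_degreeLE θ))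
      (Submodule.smul_mem _ c' (hazardPoly_mem_degreeLE θ'))
      (by simpa only [eval_smul, eval_hazardPoly, smul_eq_mul] using h) t

lemma Design.add_baseCumHazard_eq_zero_of_forall_mem (hJ : m + 1 < J.card) {v : Param m}
    {a b w : ℝ} (h : ∀ j ∈ J, a * baseCumHazard θ (S.t j + w) + b * baseHazard θ (S.t j + w)
      + baseCumHazard v (S.t j + w) = 0) (t : ℝ) :
    a * baseCumHazard θ t + b * baseHazard θ t + baseCumHazard v t = 0 := by
  have hmem : a • hazardPoly θ + b • derivative (hazardPoly θ) + hazardPoly v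
      ∈ degreeLE ℝ (m + 1 : ℕ) :=
    add_mem (add_mem (Submodule.smul_mem _ a (hazardPoly_mem_degreeLE θ))
      (Submodule.smul_mem _ b (derivative_hazardPoly_mem_degreeLE θ))) (hazardPoly_mem_degreeLE v)
  have heval := S.eval_eq_of_eval_t_eq hJ hmem (zero_mem _) (w := w) (w' := w)
    (by simpa only [eval_add, eval_smul, eval_hazardPoly, eval_derivative_hazardPoly, smul_eq_mul,
      eval_zero] using h) (t - w)
  simpa only [sub_add_cancel, eval_add, eval_smul, eval_hazardPoly, eval_derivative_hazardPoly,
    smul_eq_mul, eval_zero] using heval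

lemma Design.lt_card_Iic_k (hk : m + 1 ≤ (S.k : ℕ)) : m + 1 < (Finset.Iic S.k).card := by
  rw [Fin.card_Iic]
  omega

lemma Design.lt_card_Ici_k (hk : m + 1 ≤ L - (S.k : ℕ)) : m + 1 < (Finset.Ici S.k).card := by
  rw [Fin.card_Ici]
  omega

end Interpolation

/-! ### Log-concavity of the cumulative baseline hazard -/

/-- The derivative of the baseline hazard. -/
def baseHazardDeriv (θ : Param m) (t : ℝ) : ℝ :=
  ∑ i : Fin (m + 1), gam θ i * ((i : ℕ) * t ^ ((i : ℕ) - 1))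

lemma hasDerivAt_baseHazard (θ : Param m) (t : ℝ) :
    HasDerivAt (baseHazard θ) (baseHazardDeriv θ t) t :=
  HasDerivAt.fun_sum fun i _ => (hasDerivAt_pow (i : ℕ) t).const_mul (gam θ i)

-- In degree `m = 3` the term `(γ₀ - γ₃ t³ / 2)²` absorbs the only negative product `γ₀ γ₃`; in
-- degree `m = 4` the cumulative hazard `t + t⁵ / 5` is not log-concave.
lemma baseCumHazard_mul_baseHazardDeriv_lt (hm : m ≤ 3) (hθ : θ ∈ paramSpace m) {t : ℝ}
    (ht : 0 < t) : baseCumHazard θ t * baseHazardDeriv θ t < baseHazard θ t ^ 2 := by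
  have hγ : ∀ i, 0 < gam θ i := fun i => hθ _
  rw [← sub_pos]
  interval_cases m
  · suffices baseHazard θ t ^ 2 - baseCumHazard θ t * baseHazardDeriv θ t = gam θ 0 ^ 2 from
      this ▸ pow_pos (hγ 0) 2
    simp [baseCumHazard, baseHazard, baseHazardDeriv]
  · suffices hdiff : baseHazard θ t ^ 2 - baseCumHazard θ t * baseHazardDeriv θ t
        = gam θ 0 ^ 2 + gam θ 0 * gam θ 1 * t + gam θ 1 ^ 2 * t ^ 2 / 2 by
      rw [hdiff]
      have := hγ 0; have := hγ 1
      positivity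
    simp [baseCumHazard, baseHazard, baseHazardDeriv, Fin.sum_univ_two]
    ring
  · suffices hdiff : baseHazard θ t ^ 2 - baseCumHazard θ t * baseHazardDeriv θ t
        = gam θ 0 ^ 2 + gam θ 0 * gam θ 1 * t + gam θ 1 ^ 2 * t ^ 2 / 2
          + 2 / 3 * (gam θ 1 * gam θ 2) * t ^ 3 + gam θ 2 ^ 2 * t ^ 4 / 3 by
      rw [hdiff]
      have := hγ 0; have := hγ 1; have := hγ 2
      positivity
    simp [baseCumHazard, baseHazard, baseHazardDeriv, Fin.sum_univ_three]
    ring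
  · suffices hdiff : baseHazard θ t ^ 2 - baseCumHazard θ t * baseHazardDeriv θ t
        = (gam θ 0 - gam θ 3 * t ^ 3 / 2) ^ 2 + gam θ 0 * gam θ 1 * t + gam θ 1 ^ 2 * t ^ 2 / 2
          + 2 / 3 * (gam θ 1 * gam θ 2) * t ^ 3 + gam θ 2 ^ 2 * t ^ 4 / 3
          + gam θ 1 * gam θ 3 * t ^ 4 / 4 + gam θ 2 * gam θ 3 * t ^ 5 / 2 by
      rw [hdiff]
      have := hγ 0; have := hγ 1; have := hγ 2; have := hγ 3
      positivity
    simp [baseCumHazard, baseHazard, baseHazardDeriv, Fin.sum_univ_four]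
    ring

lemma baseHazard_div_baseCumHazard_strictAntiOn (hm : m ≤ 3) (hθ : θ ∈ paramSpace m) :
    StrictAntiOn (fun t => baseHazard θ t / baseCumHazard θ t) (Set.Ioi 0) := by
  have hderiv : ∀ t ∈ Set.Ioi (0 : ℝ), HasDerivAt (fun t => baseHazard θ t / baseCumHazard θ t)
      ((baseHazardDeriv θ t * baseCumHazard θ t - baseHazard θ t * baseHazard θ t)
        / baseCumHazard θ t ^ 2) t := fun t ht =>
    (hasDerivAt_baseHazard θ t).div (hasDerivAt_baseCumHazard θ t)
      (baseCumHazard_pos_of_mem hθ ht).ne'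
  refine strictAntiOn_of_deriv_neg (convex_Ioi 0)
    (fun t ht => (hderiv t ht).continuousAt.continuousWithinAt) fun t ht => ?_
  rw [interior_Ioi] at ht
  rw [(hderiv t ht).deriv]
  refine div_neg_of_neg_of_pos ?_ (pow_pos (baseCumHazard_pos_of_mem hθ ht) 2)
  rw [mul_comm, ← pow_two, sub_neg]
  exact baseCumHazard_mul_baseHazardDeriv_lt hm hθ ht

lemma baseCumHazard_mul_baseHazard_lt (hm : m ≤ 3) (hθ : θ ∈ paramSpace m) {s t : ℝ} (hs : 0 < s)
    (hst : s < t) : baseCumHazard θ s * baseHazard θ t < baseCumHazard θ t * baseHazard θ s := by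
  have hlt := baseHazard_div_baseCumHazard_strictAntiOn hm hθ hs (hs.trans hst) hst
  rw [div_lt_div_iff₀ (baseCumHazard_pos_of_mem hθ (hs.trans hst))
    (baseCumHazard_pos_of_mem hθ hs)] at hlt
  linarith

lemma baseCumHazard_add_div_strictAntiOn (hm : m ≤ 3) (hθ : θ ∈ paramSpace m) {d : ℝ}
    (hd : 0 < d) :
    StrictAntiOn (fun v => baseCumHazard θ (d + v) / baseCumHazard θ v) (Set.Ioi 0) := by
  have hderiv : ∀ v ∈ Set.Ioi (0 : ℝ),
      HasDerivAt (fun v => baseCumHazard θ (d + v) / baseCumHazard θ v)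
        ((baseHazard θ (d + v) * baseCumHazard θ v - baseCumHazard θ (d + v) * baseHazard θ v)
          / baseCumHazard θ v ^ 2) v := fun v hv =>
    ((hasDerivAt_baseCumHazard θ (d + v)).comp_const_add d v).div (hasDerivAt_baseCumHazard θ v)
      (baseCumHazard_pos_of_mem hθ hv).ne'
  refine strictAntiOn_of_deriv_neg (convex_Ioi 0)
    (fun v hv => (hderiv v hv).continuousAt.continuousWithinAt) fun v hv => ?_
  rw [interior_Ioi] at hv
  rw [(hderiv v hv).deriv]
  refine div_neg_of_neg_of_pos ?_ (pow_pos (baseCumHazard_pos_of_mem hθ hv) 2)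
  rw [mul_comm, sub_neg]
  exact baseCumHazard_mul_baseHazard_lt hm hθ hv (lt_add_of_pos_left v hd)

/-! ### Identifiability from many inspections in one phase -/

section Identifiability

variable {θ₀ : Param m} {u u₀ : ℝ}

variable (S) in
lemma Design.eq_of_exp_mul_baseCumHazard_eq {x : ℝ}
    (h : ∀ t, Real.exp (slope θ * x) * baseCumHazard θ t
      = Real.exp (slope θ₀ * x) * baseCumHazard θ₀ t)
    (hu : S.IsEquivTime θ u) (hu₀ : S.IsEquivTime θ₀ u) (hpos : 0 < baseCumHazard θ₀ S.τ) :
    θ = θ₀ := by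
  have hslope : slope θ = slope θ₀ := by
    have hratio := exp_mul_eq_iff.1 hu.2.2
    have hratio₀ := exp_mul_eq_iff.1 hu₀.2.2
    have hcancel : Real.exp (slope θ * (S.x₁ - S.x₂)) = Real.exp (slope θ₀ * (S.x₁ - S.x₂)) := by
      refine mul_right_cancel₀ (mul_pos (Real.exp_pos (slope θ₀ * x)) hpos).ne' ?_
      linear_combination h u - Real.exp (slope θ * x) * hratio
        + Real.exp (slope θ₀ * x) * hratio₀
        - Real.exp (slope θ * (S.x₁ - S.x₂)) * h S.τ
    exact mul_right_cancel₀ (sub_neg.2 S.stress_lt).ne (Real.exp_injective hcancel)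
  refine param_ext hslope fun t => mul_left_cancel₀ (Real.exp_pos (slope θ₀ * x)).ne' ?_
  rw [← h, hslope]

lemma Design.cumHazard_eq_of_cellProb_eq (h : S.cellProb θ = S.cellProb θ₀) (j : Fin (L + 1)) :
    S.cumHazard θ (S.t j) = S.cumHazard θ₀ (S.t j) := by
  rw [S.cumHazard_t, S.cumHazard_t, h]

lemma Design.baseCumHazard_τ_pos_of_cellProb_eq (hθ : ∀ i, 0 ≤ θ i) (hθ₀ : θ₀ ∈ paramSpace m)
    (h : S.cellProb θ = S.cellProb θ₀) : 0 < baseCumHazard θ S.τ :=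
  S.baseCumHazard_τ_pos_of_cumHazard hθ
    ((S.cumHazard_τ_pos hθ₀).trans_eq (S.cumHazard_eq_of_cellProb_eq h S.k).symm)

lemma Design.IsEquivTime.cumHazard_div_cumHazard_τ (h : S.IsEquivTime θ u) (hθ : ∀ i, 0 ≤ θ i)
    (hpos : 0 < baseCumHazard θ S.τ) {t : ℝ} (ht : S.τ ≤ t) :
    S.cumHazard θ t / S.cumHazard θ S.τ
      = baseCumHazard θ (t - S.τ + u) / baseCumHazard θ u := by
  rw [h.cumHazard_of_ge hθ hpos ht, h.cumHazard_of_ge hθ hpos le_rfl, sub_self, zero_add,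
    mul_div_mul_left _ _ (Real.exp_pos _).ne']

/-- The first phase determines the baseline hazard up to a factor; the growth of the cumulative
hazard after the stress change then determines the equivalent time, by log-concavity. -/
theorem Design.identifiableAt_of_le_k (hm : m ≤ 3) (hk : m + 1 ≤ (S.k : ℕ))
    (hθ₀ : θ₀ ∈ paramSpace m) : S.IdentifiableAt θ₀ := by
  intro θ hθ hπ
  have hθ₀' : ∀ i, 0 ≤ θ₀ i := fun i => (hθ₀ i).le
  have hpos := S.baseCumHazard_τ_pos_of_cellProb_eq hθ hθ₀ hπ
  have hpos₀ := baseCumHazard_pos_of_mem hθ₀ S.τ_pos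
  have hH := S.cumHazard_eq_of_cellProb_eq hπ
  obtain ⟨u, hu⟩ := S.exists_isEquivTime hθ
  obtain ⟨u₀, hu₀⟩ := S.exists_isEquivTime hθ₀'
  have hprop : ∀ t, Real.exp (slope θ * S.x₁) * baseCumHazard θ t
      = Real.exp (slope θ₀ * S.x₁) * baseCumHazard θ₀ t := by
    simpa only [add_zero] using S.mul_baseCumHazard_eq_of_forall_mem (S.lt_card_Iic_k hk)
      (w := 0) (w' := 0) fun j hj => by
        have hj : S.t j ≤ S.τ := S.t_strictMono.monotone (Finset.mem_Iic.1 hj)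
        rw [add_zero, ← hu.cumHazard_of_le hθ hpos hj, ← hu₀.cumHazard_of_le hθ₀' hpos₀ hj, hH]
  set T := S.t (Fin.last L)
  have hratio : baseCumHazard θ₀ (T - S.τ + u) / baseCumHazard θ₀ u
      = baseCumHazard θ₀ (T - S.τ + u₀) / baseCumHazard θ₀ u₀ :=
    calc _ = baseCumHazard θ (T - S.τ + u) / baseCumHazard θ u := by
          rw [← mul_div_mul_left _ _ (Real.exp_pos (slope θ₀ * S.x₁)).ne', ← hprop, ← hprop,
            mul_div_mul_left _ _ (Real.exp_pos _).ne']
      _ = S.cumHazard θ T / S.cumHazard θ S.τ :=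
          (hu.cumHazard_div_cumHazard_τ hθ hpos S.τ_lt_last.le).symm
      _ = S.cumHazard θ₀ T / S.cumHazard θ₀ S.τ := congrArg₂ (· / ·) (hH _) (hH S.k)
      _ = _ := hu₀.cumHazard_div_cumHazard_τ hθ₀' hpos₀ S.τ_lt_last.le
  obtain rfl : u = u₀ := (baseCumHazard_add_div_strictAntiOn hm hθ₀
    (sub_pos.2 S.τ_lt_last)).injOn (hu.pos hpos) (hu₀.pos hpos₀) hratio
  exact S.eq_of_exp_mul_baseCumHazard_eq hprop hu hu₀ hpos₀

lemma le_of_mul_baseCumHazard_add_eq {θ' : Param m} (hθ' : ∀ i, 0 ≤ θ' i) {r : ℝ}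
    (hr : 0 < baseCumHazard θ' r) {c c' : ℝ} (hc' : 0 < c') {w w' : ℝ}
    (h : ∀ t, c * baseCumHazard θ (t + w) = c' * baseCumHazard θ' (t + w')) : w' ≤ w := by
  by_contra! hlt
  have hzero := h (-w)
  rw [neg_add_cancel, baseCumHazard_zero, mul_zero] at hzero
  exact (mul_pos hc' (baseCumHazard_pos hθ' hr (by linarith))).ne hzero

/-- The second phase determines the shifted baseline hazard up to a factor, and the zero of the
cumulative hazard determines the shift. -/
theorem Design.identifiableAt_of_le_sub_k (hk : m + 1 ≤ L - (S.k : ℕ))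
    (hθ₀ : θ₀ ∈ paramSpace m) : S.IdentifiableAt θ₀ := by
  intro θ hθ hπ
  have hθ₀' : ∀ i, 0 ≤ θ₀ i := fun i => (hθ₀ i).le
  have hpos := S.baseCumHazard_τ_pos_of_cellProb_eq hθ hθ₀ hπ
  have hpos₀ := baseCumHazard_pos_of_mem hθ₀ S.τ_pos
  obtain ⟨u, hu⟩ := S.exists_isEquivTime hθ
  obtain ⟨u₀, hu₀⟩ := S.exists_isEquivTime hθ₀'
  have hprop := S.mul_baseCumHazard_eq_of_forall_mem (S.lt_card_Ici_k hk) (θ := θ) (θ' := θ₀)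
    (c := Real.exp (slope θ * S.x₂)) (c' := Real.exp (slope θ₀ * S.x₂))
    (w := u - S.τ) (w' := u₀ - S.τ) fun j hj => by
      have hj : S.τ ≤ S.t j := S.t_strictMono.monotone (Finset.mem_Ici.1 hj)
      rw [← add_comm_sub, ← add_comm_sub, ← hu.cumHazard_of_ge hθ hpos hj,
        ← hu₀.cumHazard_of_ge hθ₀' hpos₀ hj, S.cumHazard_eq_of_cellProb_eq hπ]
  have hle := le_of_mul_baseCumHazard_add_eq hθ₀' hpos₀ (Real.exp_pos _) hprop
  have hge := le_of_mul_baseCumHazard_add_eq hθ hpos (Real.exp_pos _) fun t => (hprop t).symm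
  obtain rfl : u = u₀ := by linarith
  refine S.eq_of_exp_mul_baseCumHazard_eq (x := S.x₂) (fun t => ?_) hu hu₀ hpos₀
  simpa only [sub_add_cancel] using hprop (t - (u - S.τ))

end Identifiability

/-! ### The Jacobian matrix has full column rank -/

section Jacobian

variable {v : Param m}

lemma baseCumHazard_add_smul (θ v : Param m) (r t : ℝ) :
    baseCumHazard (θ + r • v) t = baseCumHazard θ t + r * baseCumHazard v t := by
  simp only [baseCumHazard, gam, PiLp.add_apply, PiLp.smul_apply, smul_eq_mul]
  rw [Finset.mul_sum, ← Finset.sum_add_distrib]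
  exact Finset.sum_congr rfl fun i _ => by ring

lemma slope_add_smul (θ v : Param m) (r : ℝ) : slope (θ + r • v) = slope θ + r * slope v := by
  simp [slope]

lemma hasDerivAt_exp_slope_mul_baseCumHazard (θ v : Param m) (x : ℝ) {g : ℝ → ℝ} {g' : ℝ}
    (hg : HasDerivAt g g' 0) :
    HasDerivAt (fun r : ℝ => Real.exp (slope (θ + r • v) * x) * baseCumHazard (θ + r • v) (g r))
      (Real.exp (slope θ * x) * (slope v * x * baseCumHazard θ (g 0) + g' * baseHazard θ (g 0)
        + baseCumHazard v (g 0))) 0 := by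
  simp only [slope_add_smul, baseCumHazard_add_smul]
  have hexp := ((((hasDerivAt_id (0 : ℝ)).mul_const (slope v)).const_add (slope θ)).mul_const
    x).exp
  have hbase : ∀ θ : Param m, HasDerivAt (fun r => baseCumHazard θ (g r))
      (baseHazard θ (g 0) * g') 0 := fun θ => (hasDerivAt_baseCumHazard θ (g 0)).comp 0 hg
  refine (hexp.fun_mul
    ((hbase θ).fun_add ((hasDerivAt_id (0 : ℝ)).fun_mul (hbase v)))).congr_deriv ?_
  simp only [id, zero_mul, one_mul, add_zero]
  ring

lemma hasDerivAt_add_smul (θ v : Param m) : HasDerivAt (fun r : ℝ => θ + r • v) v 0 := by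
  simpa using ((hasDerivAt_id (0 : ℝ)).smul_const v).const_add θ

lemma Design.hasDerivAt_cumHazard_t_eq_zero (hθ : θ ∈ paramSpace m)
    (hv : ∀ j, fderiv ℝ (fun θ : Param m => S.cellProb θ j) θ v = 0) (j : Fin (L + 1)) :
    HasDerivAt (fun r : ℝ => S.cumHazard (θ + r • v) (S.t j)) 0 0 := by
  have hcell : ∀ i, HasDerivAt (fun r : ℝ => S.cellProb (θ + r • v) i) 0 0 := fun i => by
    have hdiff := differentiableAt_pi.1 (S.differentiableAt_cellProb hθ) i
    have hcomp := hdiff.hasFDerivAt.comp_hasDerivAt_of_eq (0 : ℝ) (hasDerivAt_add_smul θ v)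
      (by simp)
    rwa [hv i] at hcomp
  have hsum : HasDerivAt (fun r : ℝ => 1 - ∑ i ∈ Finset.Iio j, S.cellProb (θ + r • v) i) 0 0 := by
    simpa using (HasDerivAt.fun_sum (u := Finset.Iio j) fun i _ => hcell i).const_sub 1
  have hne : 1 - ∑ i ∈ Finset.Iio j, S.cellProb (θ + (0 : ℝ) • v) i ≠ 0 := by
    rw [← S.reliability_t]
    exact (Real.exp_pos _).ne'
  simp only [S.cumHazard_t]
  simpa using (hsum.log hne).fun_neg

lemma Design.add_baseCumHazard_eq_zero_of_le_k (hθ : θ ∈ paramSpace m)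
    (hv : ∀ j, fderiv ℝ (fun θ : Param m => S.cellProb θ j) θ v = 0) {j : Fin (L + 1)}
    (hj : j ≤ S.k) :
    slope v * S.x₁ * baseCumHazard θ (S.t j) + baseCumHazard v (S.t j) = 0 := by
  have hmem : ∀ᶠ r in 𝓝 (0 : ℝ), θ + r • v ∈ paramSpace m :=
    (hasDerivAt_add_smul θ v).continuousAt.eventually_mem
      (by simpa using isOpen_paramSpace.mem_nhds hθ)
  have hphase : (fun r : ℝ => S.cumHazard (θ + r • v) (S.t j)) =ᶠ[𝓝 0]
      fun r => Real.exp (slope (θ + r • v) * S.x₁) * baseCumHazard (θ + r • v) (S.t j) := by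
    filter_upwards [hmem] with r hr
    obtain ⟨u, hu⟩ := S.exists_isEquivTime fun i => (hr i).le
    exact hu.cumHazard_of_le (fun i => (hr i).le) (baseCumHazard_pos_of_mem hr S.τ_pos)
      (S.t_strictMono.monotone hj)
  have hderiv := (hasDerivAt_exp_slope_mul_baseCumHazard θ v S.x₁
    (hasDerivAt_const 0 (S.t j))).congr_of_eventuallyEq hphase
  have hzero := hderiv.unique (S.hasDerivAt_cumHazard_t_eq_zero hθ hv j)
  simpa [(Real.exp_pos _).ne'] using hzero

lemma Design.exists_add_baseCumHazard_eq_zero_of_k_le (hθ : θ ∈ paramSpace m)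
    (hv : ∀ j, fderiv ℝ (fun θ : Param m => S.cellProb θ j) θ v = 0) :
    ∃ b : ℝ, ∀ j ≥ S.k, slope v * S.x₂ * baseCumHazard θ (S.t j + S.shift θ)
      + b * baseHazard θ (S.t j + S.shift θ) + baseCumHazard v (S.t j + S.shift θ) = 0 := by
  have hshift : HasDerivAt (fun r : ℝ => S.shift (θ + r • v))
      (fderiv ℝ (fun θ : Param m => S.shift θ) θ v) 0 :=
    (S.differentiableAt_shift hθ).hasFDerivAt.comp_hasDerivAt_of_eq (0 : ℝ)
      (hasDerivAt_add_smul θ v) (by simp)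
  refine ⟨fderiv ℝ (fun θ : Param m => S.shift θ) θ v, fun j hj => ?_⟩
  have hphase : (fun r : ℝ => S.cumHazard (θ + r • v) (S.t j)) = fun r =>
      Real.exp (slope (θ + r • v) * S.x₂)
        * baseCumHazard (θ + r • v) (S.t j + S.shift (θ + r • v)) :=
    funext fun r => if_neg (not_lt.2 (S.t_strictMono.monotone hj))
  have hderiv := hasDerivAt_exp_slope_mul_baseCumHazard θ v S.x₂ (hshift.const_add (S.t j))
  rw [← hphase] at hderiv
  have hzero := hderiv.unique (S.hasDerivAt_cumHazard_t_eq_zero hθ hv j)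
  simpa [(Real.exp_pos _).ne'] using hzero

lemma param_eq_zero (hslope : slope v = 0) (h : ∀ t, baseCumHazard v t = 0) : v = 0 :=
  param_ext (by simpa [slope] using hslope) fun t => by
    rw [h]
    simp [baseCumHazard, gam]

theorem Design.eq_zero_of_fderiv_cellProb_eq_zero_of_le_k (hm : m ≤ 3) (hk : m + 1 ≤ (S.k : ℕ))
    (hθ : θ ∈ paramSpace m)
    (hv : ∀ j, fderiv ℝ (fun θ : Param m => S.cellProb θ j) θ v = 0) : v = 0 := by
  obtain ⟨b, hphase₂⟩ := S.exists_add_baseCumHazard_eq_zero_of_k_le hθ hv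
  obtain ⟨u, hu⟩ := S.exists_isEquivTime fun i => (hθ i).le
  have hpos := baseCumHazard_pos_of_mem hθ S.τ_pos
  have hshift := hu.shift_eq (fun i => (hθ i).le) hpos
  have hprop : ∀ t, slope v * S.x₁ * baseCumHazard θ t + 0 * baseHazard θ t
      + baseCumHazard v t = 0 :=
    S.add_baseCumHazard_eq_zero_of_forall_mem (S.lt_card_Iic_k hk) (w := 0) fun j hj => by
      simpa using S.add_baseCumHazard_eq_zero_of_le_k hθ hv (Finset.mem_Iic.1 hj)
  set d := S.t (Fin.last L) - S.τ
  have hτ : slope v * S.x₂ * baseCumHazard θ u + b * baseHazard θ u + baseCumHazard v u = 0 := by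
    have hk := hphase₂ S.k le_rfl
    rwa [hshift, show S.t S.k + (u - S.τ) = u from add_sub_cancel _ _] at hk
  have hlast : slope v * S.x₂ * baseCumHazard θ (d + u) + b * baseHazard θ (d + u)
      + baseCumHazard v (d + u) = 0 := by
    simpa only [hshift, ← add_comm_sub] using hphase₂ (Fin.last L) (Fin.le_last _)
  have hslope : slope v = 0 := by
    have hconcave := baseCumHazard_mul_baseHazard_lt hm hθ (hu.pos hpos)
      (lt_add_of_pos_left u (sub_pos.2 S.τ_lt_last))
    have hprod : slope v * ((S.x₂ - S.x₁) * (baseCumHazard θ (d + u) * baseHazard θ u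
        - baseCumHazard θ u * baseHazard θ (d + u))) = 0 := by
      linear_combination baseHazard θ u * (hlast - hprop (d + u))
        - baseHazard θ (d + u) * (hτ - hprop u)
    exact (mul_eq_zero.1 hprod).resolve_right
      (mul_pos (sub_pos.2 S.stress_lt) (sub_pos.2 hconcave)).ne'
  exact param_eq_zero hslope fun t => by simpa [hslope] using hprop t

theorem Design.eq_zero_of_fderiv_cellProb_eq_zero_of_le_sub_k (hk : m + 1 ≤ L - (S.k : ℕ))
    (hθ : θ ∈ paramSpace m)
    (hv : ∀ j, fderiv ℝ (fun θ : Param m => S.cellProb θ j) θ v = 0) : v = 0 := by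
  obtain ⟨b, hphase₂⟩ := S.exists_add_baseCumHazard_eq_zero_of_k_le hθ hv
  have hprop := S.add_baseCumHazard_eq_zero_of_forall_mem (S.lt_card_Ici_k hk)
    fun j hj => hphase₂ j (Finset.mem_Ici.1 hj)
  have hb : b = 0 := by
    have hzero := hprop 0
    rw [baseCumHazard_zero, baseCumHazard_zero, mul_zero, zero_add, add_zero] at hzero
    exact (mul_eq_zero.1 hzero).resolve_right (baseHazard_pos hθ le_rfl).ne'
  subst hb
  have hslope : slope v = 0 := by
    have hτ : slope v * S.x₁ * baseCumHazard θ S.τ + baseCumHazard v S.τ = 0 :=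
      S.add_baseCumHazard_eq_zero_of_le_k hθ hv le_rfl
    have hprod : slope v * ((S.x₂ - S.x₁) * baseCumHazard θ S.τ) = 0 := by
      linear_combination hprop S.τ - hτ
    exact (mul_eq_zero.1 hprod).resolve_right
      (mul_pos (sub_pos.2 S.stress_lt) (baseCumHazard_pos_of_mem hθ S.τ_pos)).ne'
  exact param_eq_zero hslope fun t => by simpa [hslope] using hprop t

lemma Design.W_mulVec (θ v : Param m) (j : Fin (L + 1)) :
    (S.W θ).mulVec v.ofLp j = fderiv ℝ (fun θ' : Param m => S.cellProb θ' j) θ v := by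
  conv_rhs => rw [← (EuclideanSpace.basisFun (Fin (m + 2)) ℝ).sum_repr v, map_sum]
  simp [Design.W, partialDeriv, Matrix.mulVec, dotProduct, mul_comm]

lemma Design.injective_W_mulVec (h : ∀ v : Param m,
      (∀ j, fderiv ℝ (fun θ : Param m => S.cellProb θ j) θ v = 0) → v = 0) :
    Function.Injective (S.W θ).mulVec := by
  refine (injective_iff_map_eq_zero (S.W θ).mulVecLin).2 fun v hv => ?_
  exact congrArg WithLp.ofLp (h (WithLp.toLp 2 v) fun j => by
    rw [← S.W_mulVec]
    exact congrFun hv j)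

end Jacobian

/-! ### Asymptotic normality of minimum density power divergence estimators -/

section Asymptotics

variable {ι : Type*} [Fintype ι]

lemma sum_empirical {v : ι → ℕ} (hv : ∑ j, v j ≠ 0) : ∑ j, empirical v j = 1 := by
  simp only [empirical, ← Finset.sum_div]
  exact div_self (by exact_mod_cast hv)

theorem StronglyIdentified.tendstoInDistribution_argmin_dpd [DecidableEq ι] {E : Type*}
    [NormedAddCommGroup E] [NormedSpace ℝ E] [FiniteDimensional ℝ E] [MeasurableSpace E]
    [BorelSpace E] {β : ℝ} {π : E → ι → ℝ} {Θ : Set E} {θ₀ : E} {W : E →L[ℝ] EuclideanSpace ℝ ι}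
    {T : EuclideanSpace ℝ ι →L[ℝ] E} (hid : StronglyIdentified π Θ θ₀) (hβ : 0 ≤ β) (hΘ : Θ ∈ 𝓝 θ₀)
    (hpos : ∀ θ ∈ Θ, ∀ j, 0 < π θ j) (hsum : ∀ θ ∈ Θ, ∑ j, π θ j = 1) (hcont : ContinuousOn π Θ)
    (hW : HasFDerivAt (fun θ => WithLp.toLp 2 (π θ)) W θ₀) (hinj : Function.Injective W)
    (hT : ∀ z h, ∑ j, π θ₀ j ^ (β - 1) * ((z j - W (T z) j) * W h j) = 0)
    {Ω : ℕ → Type*} [∀ N, MeasurableSpace (Ω N)] {P : (N : ℕ) → Measure (Ω N)}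
    [∀ N, IsProbabilityMeasure (P N)] {n : (N : ℕ) → Ω N → ι → ℕ}
    (hn : ∀ N, IsMultinomial (P N) N (π θ₀) (n N)) {θhat : (N : ℕ) → Ω N → E}
    (hmeas : ∀ N, AEMeasurable (θhat N) (P N))
    (hmin : ∀ N, ∀ᵐ ω ∂P N,
      (∃ θ ∈ Θ, IsMinOn (fun θ' => dpd β (empirical (n N ω)) (π θ')) Θ θ) →
        θhat N ω ∈ Θ ∧ IsMinOn (fun θ' => dpd β (empirical (n N ω)) (π θ')) Θ (θhat N ω)) :
    TendstoInDistribution (fun (N : ℕ) ω => √(N : ℝ) • (θhat N ω - θ₀)) atTop T P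
      (multivariateGaussian 0 (multinomialCov (π θ₀))) := by
  have hp : ∀ j, 0 ≤ π θ₀ j := fun j => (hpos θ₀ (mem_of_mem_nhds hΘ) j).le
  have hs : ∑ j, π θ₀ j = 1 := hsum θ₀ (mem_of_mem_nhds hΘ)
  refine tendstoInDistribution_delta_method
    (Real.tendsto_sqrt_atTop.comp tendsto_natCast_atTop_atTop)
    (IsMultinomial.tendstoInDistribution_empiricalError hn hp hs) T hmeas fun ε hε => ?_
  have hlim : Tendsto (fun z : EuclideanSpace ℝ ι => z.ofLp + π θ₀) (𝓝 0) (𝓝 (π θ₀)) :=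
    Continuous.tendsto' (by fun_prop) _ _ (by simp)
  obtain ⟨δ, hδ, hball⟩ := Metric.eventually_nhds_iff.1 (hlim.eventually
    ((hid.eventually_exists_isMinOn_dpd hβ hΘ hpos hsum hcont).and
      (hid.eventually_norm_argmin_dpd_sub_le hβ hΘ hpos hsum hW hinj hT hε)))
  refine ⟨δ, hδ, ?_⟩
  filter_upwards [eventually_gt_atTop 0] with N hN
  filter_upwards [(hn N).ae_sum_eq hp hs, hmin N] with ω hω hωmin hlt
  have hemp : (empiricalError (π θ₀) (n N ω)).ofLp + π θ₀ = empirical (n N ω) := by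
    simp [empiricalError]
  obtain ⟨hexists, hbound⟩ := hball (by rwa [dist_zero_right])
  rw [hemp] at hexists hbound
  have hone := sum_empirical (hω.trans_ne hN.ne')
  obtain ⟨hmem, hmin'⟩ := hωmin (hexists hone)
  exact hbound hone _ hmem hmin'

end Asymptotics

/-! ### The case `β = 0`: maximum likelihood -/

section MaximumLikelihood

variable {ι : Type*} [Fintype ι]

lemma dpd_zero_empirical (v : ι → ℕ) {q : ι → ℝ} (hq : ∀ j, 0 < q j) :
    dpd 0 (empirical v) q = ∑ j, empirical v j * Real.log (empirical v j)
      - (∑ j, v j * Real.log (q j)) / ∑ j, (v j : ℝ) := by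
  rw [dpd, if_pos rfl, Finset.sum_div, ← Finset.sum_sub_distrib]
  refine Finset.sum_congr rfl fun j _ => ?_
  rw [mul_div_right_comm, ← empirical]
  rcases eq_or_ne (empirical v j) 0 with hzero | hne
  · simp [hzero]
  · rw [Real.log_div hne (hq j).ne', mul_sub]

lemma isMinOn_dpd_zero_iff {E : Type*} {π : E → ι → ℝ} {Θ : Set E} {θ : E}
    (hpos : ∀ θ ∈ Θ, ∀ j, 0 < π θ j) (hθ : θ ∈ Θ) (v : ι → ℕ) :
    IsMinOn (fun θ' => dpd 0 (empirical v) (π θ')) Θ θ ↔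
      IsMaxOn (fun θ' => ∑ j, (v j : ℝ) * Real.log (π θ' j)) Θ θ := by
  rw [isMinOn_iff, isMaxOn_iff]
  refine forall₂_congr fun θ' hθ' => ?_
  rw [dpd_zero_empirical v (hpos θ hθ), dpd_zero_empirical v (hpos θ' hθ'), sub_le_sub_iff_left]
  rcases (Finset.sum_nonneg fun j _ => Nat.cast_nonneg (v j) : (0 : ℝ) ≤ ∑ j, (v j : ℝ)).eq_or_lt
    with hzero | hN
  · have hv : ∀ j, (v j : ℝ) = 0 := fun j =>
      (Finset.sum_eq_zero_iff_of_nonneg fun i _ => Nat.cast_nonneg (v i)).1 hzero.symm j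
        (Finset.mem_univ j)
    simp [hv]
  · exact div_le_div_iff_of_pos_right hN

lemma Design.isMDPDE_zero_iff (S : Design L) (v : Fin (L + 1) → ℕ) (θ : Param m) :
    S.IsMDPDE 0 v θ ↔ S.IsMLE v θ :=
  and_congr_right fun hθ => isMinOn_dpd_zero_iff (fun _ hθ' => S.cellProb_pos hθ') hθ v

end MaximumLikelihood

/-! ### The asymptotic covariance matrix -/

section AsymptoticCovariance

lemma isUnit_det_transpose_mul_diagonal_mul_iff {ι κ : Type*} [Fintype ι] [Fintype κ]
    [DecidableEq ι] [DecidableEq κ] {d : ι → ℝ} (hd : ∀ j, 0 < d j) (A : Matrix ι κ ℝ) :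
    IsUnit (A.transpose * Matrix.diagonal d * A).det ↔ Function.Injective A.mulVec := by
  rw [← Matrix.isUnit_iff_isUnit_det]
  constructor
  · intro hunit v w hvw
    refine Matrix.mulVec_injective_iff_isUnit.2 hunit ?_
    simp only [← Matrix.mulVec_mulVec, hvw]
  · intro hA
    rw [← Matrix.conjTranspose_eq_transpose_of_trivial]
    exact ((Matrix.PosDef.diagonal hd).conjTranspose_mul_mul_same hA).isUnit

lemma diagonal_rpow_sub_vecMulVec {ι : Type*} [Fintype ι] [DecidableEq ι] {p : ι → ℝ}
    (hp : ∀ j, 0 < p j) (β : ℝ) :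
    Matrix.diagonal (fun j => p j ^ (2 * β - 1))
        - Matrix.vecMulVec (fun j => p j ^ β) (fun j => p j ^ β)
      = Matrix.diagonal (fun j => p j ^ (β - 1)) * multinomialCov p
        * Matrix.diagonal (fun j => p j ^ (β - 1)) := by
  have hβ : ∀ j, p j ^ β = p j ^ (β - 1) * p j := fun j => by
    rw [← Real.rpow_add_one (hp j).ne', sub_add_cancel]
  have h2β : ∀ j, p j ^ (2 * β - 1) = p j ^ (β - 1) * p j * p j ^ (β - 1) := fun j => by
    rw [← hβ, ← Real.rpow_add (hp j)]
    ring_nf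
  rw [multinomialCov, Matrix.mul_sub, Matrix.sub_mul, Matrix.diagonal_mul_diagonal,
    Matrix.diagonal_mul_diagonal]
  simp only [h2β]
  congr 1
  ext i j
  simp only [Matrix.mul_diagonal, Matrix.diagonal_mul, Matrix.vecMulVec_apply, hβ]
  ring

variable (S)

lemma Design.isUnit_det_J_iff (β : ℝ) (hθ : θ ∈ paramSpace m) :
    IsUnit (S.J β θ).det ↔ Function.Injective (S.W θ).mulVec :=
  isUnit_det_transpose_mul_diagonal_mul_iff
    (fun j => Real.rpow_pos_of_pos (S.cellProb_pos hθ j) _) _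

lemma Design.identifiableAt_and_isUnit_det_J {β : ℝ} {θ₀ : Param m} (hθ₀ : θ₀ ∈ paramSpace m)
    (hreg : (m ≤ 3 ∧ m + 1 ≤ (S.k : ℕ)) ∨ m + 1 ≤ L - (S.k : ℕ) ∨
      (S.IdentifiableAt θ₀ ∧ IsUnit (S.J β θ₀).det)) :
    S.IdentifiableAt θ₀ ∧ IsUnit (S.J β θ₀).det := by
  rcases hreg with ⟨hm, hk⟩ | hk | hidJ
  · exact ⟨S.identifiableAt_of_le_k hm hk hθ₀, (S.isUnit_det_J_iff β hθ₀).2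
      (injective_W_mulVec fun _ => eq_zero_of_fderiv_cellProb_eq_zero_of_le_k hm hk hθ₀)⟩
  · exact ⟨S.identifiableAt_of_le_sub_k hk hθ₀, (S.isUnit_det_J_iff β hθ₀).2
      (injective_W_mulVec fun _ => eq_zero_of_fderiv_cellProb_eq_zero_of_le_sub_k hk hθ₀)⟩
  · exact hidJ

/-- The matrix `J_β⁻¹ Wᵀ D^(β-1)` through which the estimator depends on `p̂` to first order:
coordinates of the projection onto the range of `W` that is orthogonal with respect to the
weights `π^(β-1)`. -/
def Design.influence (β : ℝ) (θ : Param m) : Matrix (Fin (m + 2)) (Fin (L + 1)) ℝ :=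
  (S.J β θ)⁻¹ * (S.W θ).transpose * S.Dpow θ (β - 1)

lemma Design.transpose_J (β : ℝ) (θ : Param m) : (S.J β θ).transpose = S.J β θ := by
  rw [Design.J, Matrix.transpose_mul, Matrix.transpose_mul, Matrix.transpose_transpose,
    Design.Dpow, Matrix.diagonal_transpose, Matrix.mul_assoc]

lemma Design.sum_mul_sub_influence_mul_eq_zero {β : ℝ} (hJ : IsUnit (S.J β θ).det)
    (z : Fin (L + 1) → ℝ) (v : Fin (m + 2) → ℝ) :
    ∑ j, S.cellProb θ j ^ (β - 1) * ((z j - (S.W θ).mulVec ((S.influence β θ).mulVec z) j)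
      * (S.W θ).mulVec v j) = 0 := by
  have hnormal : (S.W θ).transpose * S.Dpow θ (β - 1) * (1 - S.W θ * S.influence β θ) = 0 := by
    rw [Matrix.mul_sub, Matrix.mul_one, ← Matrix.mul_assoc, ← Design.J, Design.influence,
      Matrix.mul_assoc (S.J β θ)⁻¹, Matrix.mul_nonsing_inv_cancel_left _ _ hJ, sub_self]
  calc _ = v ⬝ᵥ ((S.W θ).transpose * S.Dpow θ (β - 1)
          * (1 - S.W θ * S.influence β θ)).mulVec z := by
        rw [Matrix.mul_assoc, ← Matrix.mulVec_mulVec, ← Matrix.mulVec_mulVec,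
          Matrix.dotProduct_mulVec, Matrix.vecMul_transpose, Matrix.sub_mulVec, Matrix.one_mulVec,
          ← Matrix.mulVec_mulVec]
        refine Finset.sum_congr rfl fun j _ => ?_
        rw [Design.Dpow, Matrix.mulVec_diagonal, Pi.sub_apply]
        ring
    _ = 0 := by rw [hnormal, Matrix.zero_mulVec, dotProduct_zero]

lemma Design.asympCov_eq (β : ℝ) (hθ : θ ∈ paramSpace m) :
    S.asympCov β θ = S.influence β θ * multinomialCov (S.cellProb θ)
      * (S.influence β θ).transpose := by
  have htranspose : (S.influence β θ).transpose
      = S.Dpow θ (β - 1) * (S.W θ * (S.J β θ)⁻¹) := by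
    rw [Design.influence, Matrix.transpose_mul, Matrix.transpose_mul, Matrix.transpose_transpose,
      Matrix.transpose_nonsing_inv, S.transpose_J, Design.Dpow, Matrix.diagonal_transpose]
  rw [htranspose, Design.asympCov, Design.K, Design.influence, Design.Dpow, Design.Dpow,
    diagonal_rpow_sub_vecMulVec (S.cellProb_pos hθ)]
  simp only [Matrix.mul_assoc]

lemma Design.posSemidef_asympCov (β : ℝ) (hθ : θ ∈ paramSpace m) :
    (S.asympCov β θ).PosSemidef := by
  rw [S.asympCov_eq β hθ, ← Matrix.conjTranspose_eq_transpose_of_trivial]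
  exact (posSemidef_multinomialCov (fun j => (S.cellProb_pos hθ j).le)
    (S.sum_cellProb θ)).mul_mul_conjTranspose_same _

lemma Design.hasFDerivAt_toLp_cellProb (hθ : θ ∈ paramSpace m) :
    HasFDerivAt (fun θ' : Param m => (WithLp.toLp 2 (S.cellProb θ') :
      EuclideanSpace ℝ (Fin (L + 1)))) (matrixCLM (S.W θ)) θ := by
  rw [← hasFDerivWithinAt_univ, hasFDerivWithinAt_euclidean]
  intro j
  rw [hasFDerivWithinAt_univ]
  exact (differentiableAt_pi.1 (S.differentiableAt_cellProb hθ) j).hasFDerivAt.congr_fderiv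
    (ContinuousLinearMap.ext fun v => (S.W_mulVec θ v j).symm)

theorem Design.tendstoInDistribution_mdpde {β : ℝ} (hβ : 0 ≤ β) {θ₀ : Param m}
    (hθ₀ : θ₀ ∈ paramSpace m) (hid : S.IdentifiableAt θ₀) (hJ : IsUnit (S.J β θ₀).det)
    {Ω : ℕ → Type*} [∀ N, MeasurableSpace (Ω N)] {P : (N : ℕ) → Measure (Ω N)}
    [∀ N, IsProbabilityMeasure (P N)] {n : (N : ℕ) → Ω N → Fin (L + 1) → ℕ}
    (hn : ∀ N, IsMultinomial (P N) N (S.cellProb θ₀) (n N))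
    {θhat : (N : ℕ) → Ω N → Param m} (hmeas : ∀ N, AEMeasurable (θhat N) (P N))
    (hmin : ∀ N, ∀ᵐ ω ∂(P N), (∃ θ : Param m, S.IsMDPDE β (n N ω) θ) →
      S.IsMDPDE β (n N ω) (θhat N ω)) :
    TendstoInDistribution (fun (N : ℕ) ω => √(N : ℝ) • (θhat N ω - θ₀)) atTop id P
      (multivariateGaussian 0 (S.asympCov β θ₀)) := by
  have hinj : Function.Injective (matrixCLM (S.W θ₀)) := fun v w hvw =>
    WithLp.ofLp_injective 2 ((S.isUnit_det_J_iff β hθ₀).1 hJ (congrArg WithLp.ofLp hvw))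
  have hcont : ContinuousOn (fun θ : Param m => S.cellProb θ) (paramSpace m) := fun θ hθ =>
    (S.differentiableAt_cellProb hθ).continuousAt.continuousWithinAt
  have hlim := (hid.stronglyIdentified hθ₀).tendstoInDistribution_argmin_dpd hβ
    (isOpen_paramSpace.mem_nhds hθ₀) (fun θ hθ => S.cellProb_pos hθ)
    (fun θ _ => S.sum_cellProb θ) hcont (S.hasFDerivAt_toLp_cellProb hθ₀) hinj
    (T := matrixCLM (S.influence β θ₀))
    (fun z v => S.sum_mul_sub_influence_mul_eq_zero hJ z.ofLp v.ofLp) hn hmeas hmin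
  have hlaw : (multivariateGaussian 0 (S.asympCov β θ₀)).map id
      = (multivariateGaussian 0 (multinomialCov (S.cellProb θ₀))).map
        (matrixCLM (S.influence β θ₀)) := by
    rw [Measure.map_id, S.asympCov_eq β hθ₀, multivariateGaussian_map_matrixCLM _
      (posSemidef_multinomialCov (fun j => (S.cellProb_pos hθ₀ j).le) (S.sum_cellProb θ₀))]
  refine ⟨hlim.forall_aemeasurable, aemeasurable_id, ?_⟩
  convert hlim.tendsto using 3
  exact congrArg 𝓝 (Subtype.ext hlaw)

end AsymptoticCovariance

/-! ### Fisher information -/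

section FisherInformation

variable (S)

lemma Design.inv_diagonal_cellProb (hθ : θ ∈ paramSpace m) :
    (Matrix.diagonal (S.cellProb θ))⁻¹ = S.Dpow θ (0 - 1) := by
  refine Matrix.inv_eq_right_inv ?_
  rw [Design.Dpow, Matrix.diagonal_mul_diagonal, ← Matrix.diagonal_one]
  congr 1
  funext j
  rw [zero_sub, Real.rpow_neg_one, mul_inv_cancel₀ (S.cellProb_pos hθ j).ne']

lemma Design.fisherInfo_eq_J (hθ : θ ∈ paramSpace m) : S.fisherInfo θ = S.J 0 θ := by
  have hlog : ∀ j a, partialDeriv (fun θ' => Real.log (S.cellProb θ' j)) θ a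
      = (S.cellProb θ j)⁻¹ * S.W θ j a := fun j a => by
    rw [partialDeriv, fderiv.log (differentiableAt_pi.1 (S.differentiableAt_cellProb hθ) j)
      (S.cellProb_pos hθ j).ne']
    rfl
  ext a b
  simp only [Design.fisherInfo, Matrix.of_apply, hlog]
  rw [Design.J, Matrix.mul_apply]
  refine Finset.sum_congr rfl fun j _ => ?_
  rw [Design.Dpow, Matrix.mul_diagonal, Matrix.transpose_apply, zero_sub, Real.rpow_neg_one,
    mul_mul_mul_comm, ← mul_assoc, mul_inv_cancel_left₀ (S.cellProb_pos hθ j).ne']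
  ring

lemma Design.transpose_W_mulVec_one (hθ : θ ∈ paramSpace m) :
    (S.W θ).transpose.mulVec 1 = 0 := by
  funext i
  have hderiv : fderiv ℝ (fun θ' : Param m => ∑ j, S.cellProb θ' j) θ = 0 := by
    simp only [S.sum_cellProb]
    exact fderiv_const_apply _
  rw [fderiv_fun_sum fun j _ => differentiableAt_pi.1 (S.differentiableAt_cellProb hθ) j] at hderiv
  simpa [Matrix.mulVec, dotProduct, Design.W, partialDeriv] using
    congrArg (fun f => f (EuclideanSpace.single i (1 : ℝ))) hderiv

lemma Design.K_zero (hθ : θ ∈ paramSpace m) : S.K 0 θ = S.J 0 θ := by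
  have hπ : (fun j => S.cellProb θ j ^ (0 : ℝ)) = 1 := funext fun j => Real.rpow_zero _
  rw [Design.K, Design.J, hπ, Matrix.mul_sub, Matrix.mul_vecMulVec, S.transpose_W_mulVec_one hθ,
    Matrix.zero_vecMulVec, sub_zero, mul_zero]

lemma Design.asympCov_zero (hθ : θ ∈ paramSpace m) (hJ : IsUnit (S.J 0 θ).det) :
    S.asympCov 0 θ = (S.fisherInfo θ)⁻¹ := by
  rw [Design.asympCov, S.K_zero hθ, S.fisherInfo_eq_J hθ, Matrix.nonsing_inv_mul _ hJ,
    Matrix.one_mul]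

end FisherInformation

end StepStress

end

theorem theorem3_general
    (m L : ℕ) (S : StepStress.Design L)
    (β : ℝ) (hβ : 0 ≤ β) (θ₀ : StepStress.Param m) (hθ₀ : θ₀ ∈ StepStress.paramSpace m)
    (hreg : (m ≤ 3 ∧ m + 1 ≤ (S.k : ℕ)) ∨ m + 1 ≤ L - (S.k : ℕ) ∨
      (S.IdentifiableAt θ₀ ∧ IsUnit (S.J β θ₀).det))
    (Ω : ℕ → Type*) [∀ N, MeasurableSpace (Ω N)] (P : (N : ℕ) → Measure (Ω N))
    [∀ N, IsProbabilityMeasure (P N)]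
    (n : (N : ℕ) → Ω N → Fin (L + 1) → ℕ)
    (hn : ∀ N, StepStress.IsMultinomial (P N) N (S.cellProb θ₀) (n N))
    (θhat : (N : ℕ) → Ω N → StepStress.Param m) (hmeas : ∀ N, AEMeasurable (θhat N) (P N))
    (hmin : ∀ N, ∀ᵐ ω ∂(P N), (∃ θ : StepStress.Param m, S.IsMDPDE β (n N ω) θ) →
      S.IsMDPDE β (n N ω) (θhat N ω)) :
    (DifferentiableAt ℝ (fun θ : StepStress.Param m => S.cellProb θ) θ₀ ∧
      IsUnit (S.J β θ₀).det ∧ (S.asympCov β θ₀).PosSemidef ∧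
      TendstoInDistribution (fun (N : ℕ) ω => √(N : ℝ) • (θhat N ω - θ₀)) atTop id P
        (multivariateGaussian 0 (S.asympCov β θ₀))) ∧
    (∀ (v : Fin (L + 1) → ℕ) (θ : StepStress.Param m), S.IsMDPDE 0 v θ ↔ S.IsMLE v θ) ∧
    S.fisherInfo θ₀ =
      (S.W θ₀).transpose * (Matrix.diagonal (S.cellProb θ₀))⁻¹ * S.W θ₀ ∧
    S.asympCov 0 θ₀ = (S.fisherInfo θ₀)⁻¹ := by
  obtain ⟨hid, hJ⟩ := S.identifiableAt_and_isUnit_det_J hθ₀ hreg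
  have hJ₀ : IsUnit (S.J 0 θ₀).det :=
    (S.isUnit_det_J_iff 0 hθ₀).2 ((S.isUnit_det_J_iff β hθ₀).1 hJ)
  refine ⟨⟨S.differentiableAt_cellProb hθ₀, hJ, S.posSemidef_asympCov β hθ₀,
    S.tendstoInDistribution_mdpde hβ hθ₀ hid hJ hn hmeas hmin⟩, S.isMDPDE_zero_iff, ?_,
    S.asympCov_zero hθ₀ hJ₀⟩
  rw [S.fisherInfo_eq_J hθ₀, S.inv_diagonal_cellProb hθ₀, StepStress.Design.J]

theorem theorem3
    -- linear (`m = 1`) or quadratic (`m = 2`) baseline hazard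
    (m : ℕ) (hm : m = 1 ∨ m = 2) (L : ℕ) (S : StepStress.Design L)
    -- tuning parameter and true parameter
    (β : ℝ) (hβ : 0 ≤ β) (θ₀ : StepStress.Param m) (hθ₀ : θ₀ ∈ StepStress.paramSpace m)
    -- one of the two stress phases contains at least `m + 1` inspection times; failing that,
    -- `θ₀` is assumed to be identified and `J_β(θ₀)` to be invertible
    (hreg : m + 1 ≤ (S.k : ℕ) ∨ m + 1 ≤ L - (S.k : ℕ) ∨
      (S.IdentifiableAt θ₀ ∧ IsUnit (S.J β θ₀).det))
    -- for every `N`, multinomial failure counts of `N` devices and an MDPDE based on them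
    (Ω : ℕ → Type*) [∀ N, MeasurableSpace (Ω N)] (P : (N : ℕ) → Measure (Ω N))
    [∀ N, IsProbabilityMeasure (P N)]
    (n : (N : ℕ) → Ω N → Fin (L + 1) → ℕ)
    (hn : ∀ N, StepStress.IsMultinomial (P N) N (S.cellProb θ₀) (n N))
    (θhat : (N : ℕ) → Ω N → StepStress.Param m) (hmeas : ∀ N, AEMeasurable (θhat N) (P N))
    (hmin : ∀ N, ∀ᵐ ω ∂(P N), (∃ θ : StepStress.Param m, S.IsMDPDE β (n N ω) θ) →
      S.IsMDPDE β (n N ω) (θhat N ω)) :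
    (DifferentiableAt ℝ (fun θ : StepStress.Param m => S.cellProb θ) θ₀ ∧
      IsUnit (S.J β θ₀).det ∧ (S.asympCov β θ₀).PosSemidef ∧
      TendstoInDistribution (fun (N : ℕ) ω => √(N : ℝ) • (θhat N ω - θ₀)) atTop id P
        (multivariateGaussian 0 (S.asympCov β θ₀))) ∧
    -- the case `β = 0`: maximum likelihood and the Fisher information
    (∀ (v : Fin (L + 1) → ℕ) (θ : StepStress.Param m), S.IsMDPDE 0 v θ ↔ S.IsMLE v θ) ∧
    S.fisherInfo θ₀ =
      (S.W θ₀).transpose * (Matrix.diagonal (S.cellProb θ₀))⁻¹ * S.W θ₀ ∧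
    S.asympCov 0 θ₀ = (S.fisherInfo θ₀)⁻¹ := by
  have hm₃ : m ≤ 3 := by lia
  exact theorem3_general m L S β hβ θ₀ hθ₀ (hreg.imp_left fun hk => ⟨hm₃, hk⟩)
    Ω P n hn θhat hmeas hmin
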